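/- Let $v:\mathbb R^3\to[0,\infty)$ be a bounded, measurable, radial function supported in $\{|x|\le R_0\}$, $R_0>0$, and let $\mu>0$. Let $f_0^\mu$ be the solution of the zero-energy scattering problem $(-\mu\Delta+v)f_0^\mu=0$ on $\mathbb R^3$, $\lim_{|x|\to\infty}f_0^\mu(x)=1$, and let $\mathfrak a_0^\mu:=\frac1{4\pi\mu}\int_{\mathbb R^3}v f_0^\mu\,dx$ be the scattering length. For $L>0$ let $$E_L^\mu:=\inf_{\varphi\in H^1(\{|x|\le L\}),\,\varphi\ne0}\frac{\int_{|x|\le L}(\mu|\nabla\varphi|^2+v\varphi^2)\,dx}{\int_{|x|\le L}\varphi^2\,dx}$$ and let $f_L^\mu$ be the positive Neumann ground state, i.e. the positive solution of $(-\mu\Delta+v)f_L^\mu=E_L^\mu f_L^\mu$ for $|x|<L$ with $f_L^\mu=1$ and $\partial_rf_L^\mu=0$ on $|x|=L$, extended by $f_L^\mu=1$ to $|x|\ge L$. (Both equations are understood weakly; the solutions are $C^1$.) Put $\zeta_0:=R_0^2\|v\|_{L^\infty}$ and let $\mathfrak c_0$ be the electrostatic capacity of the support of $v$, that is, $\mathfrak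 c_0=\inf\{\frac1{4\pi}\int|\nabla\varphi|^2dx:\varphi\in C_c^\infty(\mathbb R^3),\ \varphi\ge1\text{ on }\operatorname{supp}v\}$ (so $\mathfrak c_0=R_0$ if $v>0$ on $\{|x|<R_0\}$). There is a universal constant $C>0$ (independent of $v$, $R_0$, $\mu$, $L$) such that whenever $L\ge CR_0$: 1. $\displaystyle E_L^\mu\le\frac{3\mu\,\mathfrak a_0^\mu}{L^3}\Big(1+C\frac{R_0}{L}\Big)$. 2. For all $x$, $\exp(-\zeta_0^{1/2}/\mu^{1/2})\le f_L^\mu(x)\le1$; for all $x\neq0$, $1-f_L^\mu(x)\le\min\big(1-\exp(-\zeta_0^{1/2}/\mu^{1/2}),\ \mathfrak a_0^\mu/|x|\big)$; and for all $x$, $|f_0^\mu(x)-f_L^\mu(x)|\le C\,\mathfrak a_0^\mu/L$. 3. $\displaystyle\Big|\int v f_L^\mu\,dx-4\pi\mu\,\mathfrak a_0^\mu\Big|\le C\,\|v\|_{L^1}\frac{\mathfrak a_0^\mu}{L}$ and $\displaystyle\Big|\int v(f_L^\mu)^2dx-\int v(f_0^\mu)^2dx\Big|\le C R_0\frac{\mu\,\mathfrak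 a_0^\mu}{L}$. 4. For all $x\ne0$, $\displaystyle|\nabla f_L^\mu(x)|\le\frac{\mathfrak a_0^\mu(1+C R_0/L)}{|x|^2}$ and $\displaystyle|\nabla f_L^\mu(x)|\le\frac{2+C R_0/L}{|x|}$. 5. For all $x$, $\displaystyle|\nabla f_L^\mu(x)|\le\frac{C}{|x|^2+R_0^2}\Big(\mathfrak a_0^\mu+\frac{\mathfrak c_0-\mathfrak a_0^\mu}{\mu}\,\zeta_0\Big)$. -/

import Mathlib

open MeasureTheory Filter Topology

noncomputable section

/-- Three-dimensional Euclidean space. -/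
abbrev E3 : Type := EuclideanSpace ℝ (Fin 3)

/-- `f` solves the zero-energy scattering problem `(-μ Δ + v) f = 0` on `ℝ³`, `f(x) → 1` as
`|x| → ∞`. Since `v` is only bounded, the equation is understood in the weak sense; solutions are
`C¹` by elliptic regularity. -/
structure IsScatteringSolution (μ : ℝ) (v f : E3 → ℝ) : Prop where
  contDiff : ContDiff ℝ 1 f
  equation : ∀ φ : E3 → ℝ, ContDiff ℝ 1 φ → HasCompactSupport φ →
    ∫ x, (μ * inner ℝ (gradient f x) (gradient φ x) + v x * f x * φ x) = 0
  tendsto_one : Tendsto f (cocompact E3) (𝓝 1)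

/-- The scattering length `(4πμ)⁻¹ ∫ v f₀`, where `f₀` is the zero-energy scattering solution. -/
def scatteringLength (μ : ℝ) (v f₀ : E3 → ℝ) : ℝ :=
  1 / (4 * Real.pi * μ) * ∫ x, v x * f₀ x

/-- The Neumann ground state energy of `-μ Δ + v` on the ball `|x| ≤ L`: the infimum of the Rayleigh
quotient. (`C¹` functions on `ℝ³` restrict to a dense subspace of `H¹` of the ball, so this is
the infimum over `H¹`.) -/
def neumannEnergy (μ : ℝ) (v : E3 → ℝ) (L : ℝ) : ℝ :=
  sInf {q : ℝ | ∃ φ : E3 → ℝ, ContDiff ℝ 1 φ ∧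
    0 < ∫ x in Metric.closedBall 0 L, φ x ^ 2 ∧
    q = (∫ x in Metric.closedBall 0 L, (μ * ‖gradient φ x‖ ^ 2 + v x * φ x ^ 2)) /
      ∫ x in Metric.closedBall 0 L, φ x ^ 2}

/-- `f` is the positive ground state of the Neumann problem `(-μ Δ + v) f = E f` on `|x| ≤ L`,
where `E` is the ground state energy, normalized by `f = 1` on `|x| = L` and extended by `1` to
`|x| ≥ L`. The equation is in weak form, with test functions that need not vanish on the boundary.
Because `f = 1` and `∂_r f = 0` on `|x| = L`, the extended function is `C¹` on `ℝ³`. -/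
structure IsNeumannGroundState (μ : ℝ) (v : E3 → ℝ) (L : ℝ) (f : E3 → ℝ) : Prop where
  contDiff : ContDiff ℝ 1 f
  pos : ∀ x, ‖x‖ ≤ L → 0 < f x
  equation : ∀ φ : E3 → ℝ, ContDiff ℝ 1 φ →
    ∫ x in Metric.closedBall 0 L,
        (μ * inner ℝ (gradient f x) (gradient φ x) + v x * f x * φ x) =
      neumannEnergy μ v L * ∫ x in Metric.closedBall 0 L, f x * φ x
  eq_one : ∀ x, L ≤ ‖x‖ → f x = 1
  radial_deriv : ∀ x, ‖x‖ = L → fderiv ℝ f x x = 0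

/-- The electrostatic (Newtonian) capacity of a compact set `K ⊆ ℝ³`, normalized so that a ball of
radius `R` has capacity `R`. -/
def electrostaticCapacity (K : Set E3) : ℝ :=
  sInf {c : ℝ | ∃ φ : E3 → ℝ, ContDiff ℝ (⊤ : ℕ∞) φ ∧ HasCompactSupport φ ∧
    (∀ x ∈ K, 1 ≤ φ x) ∧ c = 1 / (4 * Real.pi) * ∫ x, ‖gradient φ x‖ ^ 2}

/-- `ζ₀ = R₀² ‖v‖_{L^∞}`. -/
def zetaZero (R₀ : ℝ) (v : E3 → ℝ) : ℝ :=
  R₀ ^ 2 * (eLpNorm v ⊤ volume).toReal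

end

/-! Both solutions are radial, so the problem is one-dimensional. Let `F` and `G` be the profiles of
`f₀` and `f_L` in `r = |x|`, `w = v / μ`, `e = E / μ`, and let `a` be the scattering length.
Integrated once, the equations say that `r² F'` is the primitive of `w F s²` and `r² G'` that of `(w
- e) G s²`. The flux `r² F'` increases from `0` and equals `a` outside the support. Hence `F` is
increasing, `F ≥ 1 - a / r` with equality outside the support, and `r F' ≤ 1`.

The core is the Wronskian identity `r² (G' F - F' G) = -e ∫₀ʳ G F s²` (`IsRadialNeumann.wronskian`).
It makes `G / F` decrease to `1 / F(L) ≥ 1`, so `G ≥ F`. At `r = L` it reads `e ∫₀ᴸ G F s² = a`;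
inserting `G ≥ F ≥ 1 - a / s` bounds the energy, with no trial function. That bound in turn limits
the total drop of `G / F`, so `F ≤ G ≤ (1 + 2a/L) F` and `G' ≤ (1 + 2a/L) F'`, and the estimates for
`G` are inherited from `F`; negative values of `G'` come only from the small energy term.

The exponential lower bound is Grönwall's inequality for `u' + κ u`, where `u = r F` satisfies `u''
= w u ≤ κ² u`. The last gradient bound uses `F ≤ F(R) = 1 - a / R` inside the support, which gives
`F' ≤ K (R - a) / 3` when `w ≤ K`; the true outer radius `R` of the support is at most its capacity.

Radial symmetry follows from uniqueness: the maximum principle for `f₀`, and the substitution `g = f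
h` for the positive Neumann ground state. -/

open scoped Gradient

/-! ### The one-dimensional scattering equation -/

/-- Integration by parts for two primitives of integrable functions. -/
lemma integral_by_parts_of_primitive {p q η k : ℝ → ℝ} {a b : ℝ} (hab : a ≤ b)
    (hq : IntervalIntegrable q volume a b) (hk : IntervalIntegrable k volume a b)
    (hp : ∀ x ∈ Set.Icc a b, p x = p a + ∫ s in a..x, q s)
    (hη : ∀ x ∈ Set.Icc a b, η x = η a + ∫ s in a..x, k s) :
    ∫ x in a..b, (p x * k x + q x * η x) = p b * η b - p a * η a := by
  have ha : a ∈ Set.uIcc a b := Set.left_mem_uIcc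
  have hc : ∀ c : ℝ, AbsolutelyContinuousOnInterval (fun _ : ℝ => c) a b := fun c =>
    contDiffOn_const.absolutelyContinuousOnInterval
  -- The potential is only bounded and measurable, so fluxes are differentiable only almost
  -- everywhere; absolute continuity of the primitives is what justifies integrating by parts.
  have h1 : AbsolutelyContinuousOnInterval (fun x => p a + ∫ s in a..x, q s) a b :=
    AbsolutelyContinuousOnInterval.add (hc (p a))
      (hq.absolutelyContinuousOnInterval_intervalIntegral ha)
  have h2 : AbsolutelyContinuousOnInterval (fun x => η a + ∫ s in a..x, k s) a b :=
    AbsolutelyContinuousOnInterval.add (hc (η a))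
      (hk.absolutelyContinuousOnInterval_intervalIntegral ha)
  have h3 := h1.integral_deriv_mul_eq_sub h2
  rw [← hp b ⟨hab, le_rfl⟩, ← hη b ⟨hab, le_rfl⟩, ← hp a ⟨le_rfl, hab⟩,
    ← hη a ⟨le_rfl, hab⟩] at h3
  rw [← h3]
  apply intervalIntegral.integral_congr_ae
  filter_upwards [hq.ae_hasDerivAt_integral, hk.ae_hasDerivAt_integral] with x hx1 hx2 hx
  rw [Set.uIoc_of_le hab] at hx
  have hx' : x ∈ Set.Icc a b := ⟨hx.1.le, hx.2⟩
  have hxu : x ∈ Set.uIcc a b := by rwa [Set.uIcc_of_le hab]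
  rw [((hx1 hxu a ha).const_add (p a)).deriv, ((hx2 hxu a ha).const_add (η a)).deriv,
    ← hp x hx', ← hη x hx']
  ring

lemma intervalIntegrable_bdd_mul_continuous {w h : ℝ → ℝ} {B : ℝ} (hw : Measurable w)
    (hB : ∀ r, |w r| ≤ B) (hh : Continuous h) (a b : ℝ) :
    IntervalIntegrable (fun s => w s * h s) volume a b := by
  have h1 := hh.intervalIntegrable (μ := volume) a b
  rw [intervalIntegrable_iff] at h1 ⊢
  exact h1.bdd_mul hw.aestronglyMeasurable (Eventually.of_forall hB)

/-- The radial form of the zero-energy scattering problem, integrated once. -/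
structure IsRadialScattering (w F F' : ℝ → ℝ) (R : ℝ) : Prop where
  measurable : Measurable w
  nonneg : ∀ r, 0 ≤ w r
  bdd : ∃ B, ∀ r, w r ≤ B
  radius_pos : 0 < R
  eq_zero : ∀ r, R < r → w r = 0
  hasDerivAt : ∀ r, HasDerivAt F (F' r) r
  continuous_deriv : Continuous F'
  flux : ∀ r, 0 ≤ r → r ^ 2 * F' r = ∫ s in (0 : ℝ)..r, w s * (F s * s ^ 2)
  sol_nonneg : ∀ r, 0 ≤ r → 0 ≤ F r
  tendsto_one : Tendsto F atTop (𝓝 1)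

namespace IsRadialScattering

variable {w F F' : ℝ → ℝ} {R : ℝ}

lemma continuous (S : IsRadialScattering w F F' R) : Continuous F :=
  continuous_iff_continuousAt.2 fun r => (S.hasDerivAt r).continuousAt

lemma intervalIntegrable (S : IsRadialScattering w F F' R) {h : ℝ → ℝ} (hh : Continuous h)
    (a b : ℝ) : IntervalIntegrable (fun s => w s * h s) volume a b := by
  obtain ⟨B, hB⟩ := S.bdd
  exact intervalIntegrable_bdd_mul_continuous S.measurable
    (fun r => by rw [abs_of_nonneg (S.nonneg r)]; exact hB r) hh a b

lemma flux_sub (S : IsRadialScattering w F F' R) {r s : ℝ} (hr : 0 ≤ r) (hrs : r ≤ s) :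
    s ^ 2 * F' s - r ^ 2 * F' r = ∫ t in r..s, w t * (F t * t ^ 2) := by
  have hi := S.intervalIntegrable (S.continuous.mul (continuous_pow 2))
  rw [S.flux s (hr.trans hrs), S.flux r hr]
  exact intervalIntegral.integral_interval_sub_left (hi 0 s) (hi 0 r)

lemma flux_mono (S : IsRadialScattering w F F' R) {r s : ℝ} (hr : 0 ≤ r) (hrs : r ≤ s) :
    r ^ 2 * F' r ≤ s ^ 2 * F' s := by
  rw [← sub_nonneg, S.flux_sub hr hrs]
  refine intervalIntegral.integral_nonneg hrs fun t ht => ?_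
  have := S.sol_nonneg t (hr.trans ht.1)
  have := S.nonneg t
  positivity

lemma flux_eq (S : IsRadialScattering w F F' R) {s : ℝ} (hs : R ≤ s) :
    s ^ 2 * F' s = R ^ 2 * F' R := by
  rw [← sub_eq_zero, S.flux_sub S.radius_pos.le hs, intervalIntegral.integral_of_le hs]
  exact setIntegral_eq_zero_of_forall_eq_zero fun t ht => by rw [S.eq_zero t ht.1, zero_mul]

lemma flux_nonneg (S : IsRadialScattering w F F' R) {r : ℝ} (hr : 0 ≤ r) : 0 ≤ r ^ 2 * F' r := by
  have := S.flux_mono le_rfl hr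
  simpa using this

lemma flux_le (S : IsRadialScattering w F F' R) {r : ℝ} (hr : 0 ≤ r) :
    r ^ 2 * F' r ≤ R ^ 2 * F' R := by
  rcases le_total r R with h | h
  · exact S.flux_mono hr h
  · exact (S.flux_eq h).le

lemma monotoneOn (S : IsRadialScattering w F F' R) : MonotoneOn F (Set.Ici 0) := by
  refine monotoneOn_of_deriv_nonneg (convex_Ici 0) S.continuous.continuousOn
    (fun r _ => (S.hasDerivAt r).differentiableAt.differentiableWithinAt) fun r hr => ?_
  rw [interior_Ici, Set.mem_Ioi] at hr
  rw [(S.hasDerivAt r).deriv]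
  exact nonneg_of_mul_nonneg_right (S.flux_nonneg hr.le) (by positivity)

lemma le_one (S : IsRadialScattering w F F' R) {r : ℝ} (hr : 0 ≤ r) : F r ≤ 1 :=
  ge_of_tendsto S.tendsto_one (by
    filter_upwards [eventually_ge_atTop r] with s hs
    exact S.monotoneOn hr (Set.mem_Ici.2 (hr.trans hs)) hs)

lemma hasDerivAt_add_div (S : IsRadialScattering w F F' R) (c : ℝ) {s : ℝ} (hs : s ≠ 0) :
    HasDerivAt (fun s => F s + c / s) ((s ^ 2 * F' s - c) / s ^ 2) s := by
  have h := (S.hasDerivAt s).add ((hasDerivAt_inv hs).const_mul c)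
  refine h.congr_deriv ?_
  field_simp
  ring

lemma tendsto_add_div (S : IsRadialScattering w F F' R) (c : ℝ) :
    Tendsto (fun s => F s + c / s) atTop (𝓝 1) := by
  simpa using S.tendsto_one.add (tendsto_const_nhds (x := c).div_atTop tendsto_id)

/-- `F + c / s` has derivative `(s² F' - c) / s²` and tends to `1`, so a lower bound on the flux
beyond `r` integrates to an upper bound on `F r`. `one_le_add_div` is the mirror image. -/
lemma add_div_le_one (S : IsRadialScattering w F F' R) {c r : ℝ} (hr : 0 < r)
    (hc : ∀ s, r ≤ s → c ≤ s ^ 2 * F' s) : F r + c / r ≤ 1 := by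
  have hm : MonotoneOn (fun s => F s + c / s) (Set.Ici r) := by
    refine monotoneOn_of_deriv_nonneg (convex_Ici r) (fun s hs => ?_) (fun s hs => ?_)
      fun s hs => ?_
    · exact (S.hasDerivAt_add_div c (hr.trans_le hs).ne').continuousAt.continuousWithinAt
    · rw [interior_Ici, Set.mem_Ioi] at hs
      exact (S.hasDerivAt_add_div c (hr.trans hs).ne').differentiableAt.differentiableWithinAt
    · rw [interior_Ici, Set.mem_Ioi] at hs
      rw [(S.hasDerivAt_add_div c (hr.trans hs).ne').deriv]
      exact div_nonneg (sub_nonneg.2 (hc s hs.le)) (by positivity)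
  exact ge_of_tendsto (S.tendsto_add_div c) (by
    filter_upwards [eventually_ge_atTop r] with s hs
    exact hm Set.self_mem_Ici hs hs)

lemma one_le_add_div (S : IsRadialScattering w F F' R) {c r : ℝ} (hr : 0 < r)
    (hc : ∀ s, r ≤ s → s ^ 2 * F' s ≤ c) : 1 ≤ F r + c / r := by
  have hm : AntitoneOn (fun s => F s + c / s) (Set.Ici r) := by
    refine antitoneOn_of_deriv_nonpos (convex_Ici r) (fun s hs => ?_) (fun s hs => ?_)
      fun s hs => ?_
    · exact (S.hasDerivAt_add_div c (hr.trans_le hs).ne').continuousAt.continuousWithinAt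
    · rw [interior_Ici, Set.mem_Ioi] at hs
      exact (S.hasDerivAt_add_div c (hr.trans hs).ne').differentiableAt.differentiableWithinAt
    · rw [interior_Ici, Set.mem_Ioi] at hs
      rw [(S.hasDerivAt_add_div c (hr.trans hs).ne').deriv]
      exact div_nonpos_of_nonpos_of_nonneg (sub_nonpos.2 (hc s hs.le)) (by positivity)
  exact le_of_tendsto (S.tendsto_add_div c) (by
    filter_upwards [eventually_ge_atTop r] with s hs
    exact hm Set.self_mem_Ici hs hs)

lemma one_sub_div_le (S : IsRadialScattering w F F' R) {r : ℝ} (hr : 0 < r) :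
    1 - R ^ 2 * F' R / r ≤ F r := by
  have := S.one_le_add_div hr (c := R ^ 2 * F' R) fun s hs => S.flux_le (hr.le.trans hs)
  linarith

lemma eq_one_sub_div (S : IsRadialScattering w F F' R) {r : ℝ} (hr : R ≤ r) :
    F r = 1 - R ^ 2 * F' R / r := by
  have h := S.add_div_le_one (S.radius_pos.trans_le hr) (c := R ^ 2 * F' R)
    fun s hs => (S.flux_eq (hr.trans hs)).ge
  linarith [S.one_sub_div_le (S.radius_pos.trans_le hr)]

/-- The flux beyond `r` is at least its value at `r`; taking that value for `c` in `add_div_le_one`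
gives `F r + r F' r ≤ 1`. -/
lemma mul_deriv_le (S : IsRadialScattering w F F' R) {r : ℝ} (hr : 0 < r) : r * F' r ≤ 1 := by
  have h := S.add_div_le_one hr (c := r ^ 2 * F' r) fun s hs => S.flux_mono hr.le hs
  have h2 := S.sol_nonneg r hr.le
  have h3 : r ^ 2 * F' r / r = r * F' r := by field_simp
  linarith

lemma length_nonneg (S : IsRadialScattering w F F' R) : 0 ≤ R ^ 2 * F' R :=
  S.flux_nonneg S.radius_pos.le

lemma length_le (S : IsRadialScattering w F F' R) : R ^ 2 * F' R ≤ R := by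
  have h := S.mul_deriv_le S.radius_pos
  nlinarith [S.radius_pos]

/-- In the flux integral `w` is replaced by `K` and the increasing `F` by its endpoint value. The
bound on `w` is only almost everywhere because it will come from an essential supremum. -/
lemma flux_le_of_ae_le (S : IsRadialScattering w F F' R) {K : ℝ}
    (hK : ∀ᵐ s, 0 < s → w s ≤ K) {r : ℝ} (hr : 0 ≤ r) :
    r ^ 2 * F' r ≤ K * F r * r ^ 3 / 3 := by
  have hi := S.intervalIntegrable (S.continuous.mul (continuous_pow 2)) 0 r
  have h : ∫ s in (0 : ℝ)..r, w s * (F s * s ^ 2) ≤ ∫ s in (0 : ℝ)..r, K * F r * s ^ 2 := by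
    refine intervalIntegral.integral_mono_ae_restrict hr hi
      (Continuous.intervalIntegrable (by fun_prop) _ _) ?_
    rw [Filter.EventuallyLE, ae_restrict_iff' measurableSet_Icc]
    have h0 : ∀ᵐ s : ℝ, s ≠ 0 := by simp [ae_iff, measure_singleton]
    filter_upwards [hK, h0] with s hs hs0 hsr
    have hs1 : 0 < s := lt_of_le_of_ne hsr.1 hs0.symm
    have h1 := S.monotoneOn (Set.mem_Ici.2 hsr.1) (Set.mem_Ici.2 hr) hsr.2
    have h2 := S.sol_nonneg s hsr.1
    have h3 := S.nonneg s
    calc w s * (F s * s ^ 2) ≤ K * (F r * s ^ 2) := by gcongr; exacts [h3.trans (hs hs1), hs hs1]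
      _ = _ := by ring
  rw [S.flux r hr]
  refine h.trans (le_of_eq ?_)
  rw [intervalIntegral.integral_const_mul, integral_pow]
  norm_num
  ring

/-- The derivative of `r ↦ r F(r)` is the primitive of `w r F`. -/
lemma add_mul_deriv_eq (S : IsRadialScattering w F F' R) {r : ℝ} (hr : 0 ≤ r) :
    F r + r * F' r = F 0 + ∫ s in (0 : ℝ)..r, w s * (F s * s) := by
  have hc1 : Continuous fun s => F s * s := S.continuous.mul continuous_id
  have hc2 : Continuous fun s => F s * s ^ 2 := S.continuous.mul (continuous_pow 2)
  have hi1 := S.intervalIntegrable hc1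
  -- The identity is the integration by parts of `s² F'` against `1 / s`. That factor is singular at
  -- the origin, so the integral starts at `ε`, and `ε → 0` is taken at the end.
  have key : ∀ ε, 0 < ε → ∀ r, ε ≤ r →
      F r + r * F' r = F ε + ε * F' ε + ∫ s in ε..r, w s * (F s * s) := by
    intro ε hε r hr
    have hne : ∀ s ∈ Set.Icc ε r, s ≠ 0 := fun s hs => (hε.trans_le hs.1).ne'
    have hinv : ContinuousOn (fun s : ℝ => -(s ^ 2)⁻¹) (Set.uIcc ε r) := by
      rw [Set.uIcc_of_le hr]
      exact (ContinuousOn.inv₀ (by fun_prop) fun s hs => pow_ne_zero 2 (hne s hs)).neg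
    have h := integral_by_parts_of_primitive (p := fun s => s ^ 2 * F' s)
      (q := fun s => w s * (F s * s ^ 2)) (η := fun s => s⁻¹) (k := fun s => -(s ^ 2)⁻¹) hr
      (S.intervalIntegrable hc2 ε r) hinv.intervalIntegrable
      (fun x hx => by have := S.flux_sub hε.le hx.1; linarith)
      (fun x hx => by
        have hsub : Set.uIcc ε x ⊆ Set.uIcc ε r := by
          rw [Set.uIcc_of_le hr, Set.uIcc_of_le hx.1]; exact Set.Icc_subset_Icc_right hx.2
        rw [intervalIntegral.integral_eq_sub_of_hasDerivAt (f := fun s : ℝ => s⁻¹)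
          (fun s hs => ?_) (hinv.mono hsub).intervalIntegrable]
        · ring
        · have := hsub hs
          rw [Set.uIcc_of_le hr] at this
          exact hasDerivAt_inv (hne s this))
    have h2 : ∫ x in ε..r, (x ^ 2 * F' x * -(x ^ 2)⁻¹ + w x * (F x * x ^ 2) * x⁻¹) =
        ∫ x in ε..r, (w x * (F x * x) - F' x) := by
      refine intervalIntegral.integral_congr fun x hx => ?_
      rw [Set.uIcc_of_le hr] at hx
      have := hne x hx
      field_simp
      ring
    rw [h2, intervalIntegral.integral_sub (hi1 ε r) (S.continuous_deriv.intervalIntegrable _ _),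
      intervalIntegral.integral_eq_sub_of_hasDerivAt (fun s _ => S.hasDerivAt s)
      (S.continuous_deriv.intervalIntegrable _ _)] at h
    have e1 : r ^ 2 * F' r * r⁻¹ = r * F' r := by
      have := hne r ⟨hr, le_rfl⟩
      field_simp
    have e2 : ε ^ 2 * F' ε * ε⁻¹ = ε * F' ε := by field_simp
    simp only [e1, e2] at h
    linarith
  rcases hr.eq_or_lt with rfl | hr
  · simp
  have hprim : Continuous fun x => ∫ s in x..r, w s * (F s * s) := by
    have h1 := intervalIntegral.continuous_primitive hi1 r
    exact h1.neg.congr fun x => (intervalIntegral.integral_symm r x).symm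
  have hcont : Continuous fun ε => F ε + ε * F' ε + ∫ s in ε..r, w s * (F s * s) :=
    (S.continuous.add (continuous_id.mul S.continuous_deriv)).add hprim
  have hlim : Tendsto (fun ε => F ε + ε * F' ε + ∫ s in ε..r, w s * (F s * s)) (𝓝[>] 0)
      (𝓝 (F 0 + 0 * F' 0 + ∫ s in (0 : ℝ)..r, w s * (F s * s))) :=
    (hcont.tendsto 0).mono_left nhdsWithin_le_nhds
  have hlim2 : Tendsto (fun ε => F ε + ε * F' ε + ∫ s in ε..r, w s * (F s * s)) (𝓝[>] 0)
      (𝓝 (F r + r * F' r)) := by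
    refine tendsto_const_nhds.congr' ?_
    filter_upwards [Ioo_mem_nhdsGT hr] with ε hε
    exact key ε hε.1 r hε.2.le
  simpa using tendsto_nhds_unique hlim2 hlim

end IsRadialScattering

/-! ### The exponential lower bound -/

/-- Grönwall in integral form: the right-hand side times `exp (-κ r)` is nonincreasing. -/
lemma le_mul_exp_of_le_add_integral {y : ℝ → ℝ} {A κ T : ℝ} (hκ : 0 ≤ κ) (hT : 0 ≤ T)
    (hy : Continuous y) (h : ∀ r ∈ Set.Icc 0 T, y r ≤ A + κ * ∫ s in (0 : ℝ)..r, y s) :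
    y T ≤ A * Real.exp (κ * T) := by
  have hd : ∀ r, HasDerivAt (fun r => (A + κ * ∫ s in (0 : ℝ)..r, y s) * Real.exp (-(κ * r)))
      (κ * (y r - (A + κ * ∫ s in (0 : ℝ)..r, y s)) * Real.exp (-(κ * r))) r := by
    intro r
    have h1 := ((intervalIntegral.integral_hasDerivAt_right (hy.intervalIntegrable 0 r)
      (hy.stronglyMeasurableAtFilter _ _) hy.continuousAt).const_mul κ).const_add A
    have h2 := (((hasDerivAt_id r).const_mul κ).neg).exp
    refine (h1.mul h2).congr_deriv ?_
    simp
    ring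
  have hm : AntitoneOn (fun r => (A + κ * ∫ s in (0 : ℝ)..r, y s) * Real.exp (-(κ * r)))
      (Set.Icc 0 T) := by
    refine antitoneOn_of_deriv_nonpos (convex_Icc 0 T)
      (fun r _ => (hd r).continuousAt.continuousWithinAt)
      (fun r _ => (hd r).differentiableAt.differentiableWithinAt) fun r hr => ?_
    rw [(hd r).deriv]
    have := h r (interior_subset hr)
    exact mul_nonpos_of_nonpos_of_nonneg
      (mul_nonpos_of_nonneg_of_nonpos hκ (by linarith)) (Real.exp_pos _).le
  have h0 := hm (Set.left_mem_Icc.2 hT) (Set.right_mem_Icc.2 hT) hT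
  simp only [intervalIntegral.integral_same, mul_zero, add_zero, neg_zero, Real.exp_zero,
    mul_one] at h0
  rw [Real.exp_neg, ← div_eq_mul_inv, div_le_iff₀ (Real.exp_pos _)] at h0
  exact (h T ⟨hT, le_rfl⟩).trans h0

namespace IsRadialScattering

variable {w F F' : ℝ → ℝ} {R : ℝ}

/-- With `u = r F`, formally `u'' = w u ≤ κ² u`, so `y = u' + κ u` satisfies `y' ≤ κ y` and hence `y
R ≤ F 0 * exp (κ R)`. Outside the support `u = r - a`, so `u' R = 1` and `y R ≥ 1`. Everything is
done in integrated form, since `u''` exists only almost everywhere. -/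
lemma exp_le (S : IsRadialScattering w F F' R) {κ : ℝ} (hκ : 0 ≤ κ)
    (hK : ∀ᵐ s, 0 < s → w s ≤ κ ^ 2) : Real.exp (-(κ * R)) ≤ F 0 := by
  have hFc := S.continuous
  have hF'c := S.continuous_deriv
  have hyc : Continuous fun r => F r + r * F' r + κ * (r * F r) := by fun_prop
  have hR := S.radius_pos
  have hy : ∀ r ∈ Set.Icc 0 R, F r + r * F' r + κ * (r * F r) ≤
      F 0 + κ * ∫ s in (0 : ℝ)..r, (F s + s * F' s + κ * (s * F s)) := by
    intro r hr
    have h1 : ∫ s in (0 : ℝ)..r, (F s + s * F' s) = r * F r := by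
      rw [intervalIntegral.integral_eq_sub_of_hasDerivAt (f := fun s => s * F s) (fun s _ => ?_)
        (Continuous.intervalIntegrable (by fun_prop) _ _)]
      · simp
      · exact ((hasDerivAt_id s).mul (S.hasDerivAt s)).congr_deriv (by simp)
    have h2 : ∫ s in (0 : ℝ)..r, w s * (F s * s) ≤ ∫ s in (0 : ℝ)..r, κ ^ 2 * (s * F s) := by
      refine intervalIntegral.integral_mono_ae_restrict hr.1
        (S.intervalIntegrable (by fun_prop) 0 r)
        (Continuous.intervalIntegrable (by fun_prop) _ _) ?_
      rw [Filter.EventuallyLE, ae_restrict_iff' measurableSet_Icc]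
      have h0 : ∀ᵐ s : ℝ, s ≠ 0 := by simp [ae_iff, measure_singleton]
      filter_upwards [hK, h0] with s hs hs0 hsr
      have hs1 : 0 < s := lt_of_le_of_ne hsr.1 hs0.symm
      have h2 := S.sol_nonneg s hsr.1
      rw [mul_comm (F s) s]
      gcongr
      exact hs hs1
    rw [S.add_mul_deriv_eq hr.1, intervalIntegral.integral_add
      (Continuous.intervalIntegrable (by fun_prop) _ _)
      (Continuous.intervalIntegrable (by fun_prop) _ _), h1,
      intervalIntegral.integral_const_mul]
    rw [intervalIntegral.integral_const_mul] at h2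
    nlinarith
  have h := le_mul_exp_of_le_add_integral hκ hR.le hyc hy
  have h1 : F R + R * F' R = 1 := by
    rw [S.eq_one_sub_div le_rfl]
    field_simp
    ring
  have h2 := mul_nonneg hκ (mul_nonneg hR.le (S.sol_nonneg R hR.le))
  rw [Real.exp_neg, inv_eq_one_div, div_le_iff₀ (Real.exp_pos _)]
  linarith

lemma pos (S : IsRadialScattering w F F' R) {r : ℝ} (hr : 0 ≤ r) : 0 < F r := by
  obtain ⟨B, hB⟩ := S.bdd
  have h := S.exp_le (κ := √B) (Real.sqrt_nonneg B)
    (Eventually.of_forall fun s _ => by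
      rw [Real.sq_sqrt ((S.nonneg 0).trans (hB 0))]; exact hB s)
  exact (Real.exp_pos _).trans_le (h.trans (S.monotoneOn Set.self_mem_Ici hr hr))

end IsRadialScattering

/-! ### Wronskian comparison of the Neumann and scattering solutions -/

/-- The radial form of the Neumann ground state problem, integrated once. -/
structure IsRadialNeumann (w G G' : ℝ → ℝ) (e L : ℝ) : Prop where
  energy_nonneg : 0 ≤ e
  hasDerivAt : ∀ r, HasDerivAt G (G' r) r
  continuous_deriv : Continuous G'
  flux : ∀ r, 0 ≤ r → r ≤ L → r ^ 2 * G' r = ∫ s in (0 : ℝ)..r, (w s - e) * (G s * s ^ 2)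
  pos : ∀ r, 0 ≤ r → r ≤ L → 0 < G r
  eq_one : G L = 1
  deriv_eq_zero : G' L = 0

namespace IsRadialNeumann

variable {w F F' G G' : ℝ → ℝ} {R e L : ℝ}

lemma continuous (N : IsRadialNeumann w G G' e L) : Continuous G :=
  continuous_iff_continuousAt.2 fun r => (N.hasDerivAt r).continuousAt

lemma intervalIntegrable (S : IsRadialScattering w F F' R) {h : ℝ → ℝ} (hh : Continuous h)
    (a b : ℝ) : IntervalIntegrable (fun s => (w s - e) * h s) volume a b := by
  simp_rw [sub_mul]
  exact (S.intervalIntegrable hh a b).sub (Continuous.intervalIntegrable (by fun_prop) _ _)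

/-- Integrate each flux by parts against the other solution and subtract: the terms `F' G'` and `w F
G` cancel, and only the energy term survives. -/
lemma wronskian (N : IsRadialNeumann w G G' e L) (S : IsRadialScattering w F F' R) {r : ℝ}
    (hr : 0 ≤ r) (hrL : r ≤ L) :
    r ^ 2 * G' r * F r - r ^ 2 * F' r * G r = -(e * ∫ s in (0 : ℝ)..r, G s * F s * s ^ 2) := by
  have hF := S.continuous
  have hF' := S.continuous_deriv
  have hG := N.continuous
  have hG' := N.continuous_deriv
  have i1 := S.intervalIntegrable (h := fun s => F s * s ^ 2) (by fun_prop) 0 r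
  have i2 := intervalIntegrable (e := e) S (h := fun s => G s * s ^ 2) (by fun_prop) 0 r
  have h1 := integral_by_parts_of_primitive (p := fun s => s ^ 2 * G' s)
    (q := fun s => (w s - e) * (G s * s ^ 2)) (η := F) (k := F') hr i2
    (hF'.intervalIntegrable _ _)
    (fun x hx => by simpa using N.flux x hx.1 (hx.2.trans hrL))
    (fun x hx => by
      rw [intervalIntegral.integral_eq_sub_of_hasDerivAt (fun s _ => S.hasDerivAt s)
        (hF'.intervalIntegrable _ _)]; ring)
  have h2 := integral_by_parts_of_primitive (p := fun s => s ^ 2 * F' s)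
    (q := fun s => w s * (F s * s ^ 2)) (η := G) (k := G') hr i1
    (hG'.intervalIntegrable _ _)
    (fun x hx => by simpa using S.flux x hx.1)
    (fun x hx => by
      rw [intervalIntegral.integral_eq_sub_of_hasDerivAt (fun s _ => N.hasDerivAt s)
        (hG'.intervalIntegrable _ _)]; ring)
  have j1 : IntervalIntegrable (fun x => x ^ 2 * G' x * F' x + (w x - e) * (G x * x ^ 2) * F x)
      volume 0 r := by
    refine IntervalIntegrable.add (Continuous.intervalIntegrable (by fun_prop) _ _) ?_
    exact (i2.mul_continuousOn hF.continuousOn)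
  have j2 : IntervalIntegrable (fun x => x ^ 2 * F' x * G' x + w x * (F x * x ^ 2) * G x)
      volume 0 r := by
    refine IntervalIntegrable.add (Continuous.intervalIntegrable (by fun_prop) _ _) ?_
    exact (i1.mul_continuousOn hG.continuousOn)
  have h3 := intervalIntegral.integral_sub j1 j2
  rw [h1, h2] at h3
  simp only [ne_eq, OfNat.ofNat_ne_zero, not_false_eq_true, zero_pow, zero_mul, sub_zero] at h3
  rw [← h3, ← intervalIntegral.integral_const_mul, ← intervalIntegral.integral_neg]
  refine intervalIntegral.integral_congr fun x _ => ?_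
  ring

lemma integral_nonneg (N : IsRadialNeumann w G G' e L) (S : IsRadialScattering w F F' R) {r : ℝ}
    (hr : 0 ≤ r) (hrL : r ≤ L) : 0 ≤ ∫ s in (0 : ℝ)..r, G s * F s * s ^ 2 :=
  intervalIntegral.integral_nonneg hr fun t ht => by
    have := N.pos t ht.1 (ht.2.trans hrL)
    have := S.pos ht.1
    positivity

lemma hasDerivAt_div (N : IsRadialNeumann w G G' e L) (S : IsRadialScattering w F F' R) {r : ℝ}
    (hr : 0 < r) (hrL : r ≤ L) : HasDerivAt (fun r => G r / F r)
      (-(e * ∫ s in (0 : ℝ)..r, G s * F s * s ^ 2) / (r ^ 2 * F r ^ 2)) r := by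
  have hF := (S.pos hr.le).ne'
  refine ((N.hasDerivAt r).div (S.hasDerivAt r) hF).congr_deriv ?_
  rw [← N.wronskian S hr.le hrL]
  field_simp

lemma continuousOn_div (N : IsRadialNeumann w G G' e L) (S : IsRadialScattering w F F' R) :
    ContinuousOn (fun r => G r / F r) (Set.Icc 0 L) :=
  N.continuous.continuousOn.div S.continuous.continuousOn fun _ hr => (S.pos hr.1).ne'

lemma antitoneOn_div (N : IsRadialNeumann w G G' e L) (S : IsRadialScattering w F F' R) :
    AntitoneOn (fun r => G r / F r) (Set.Icc 0 L) := by
  refine antitoneOn_of_deriv_nonpos (convex_Icc 0 L) (N.continuousOn_div S) (fun r hr => ?_)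
    fun r hr => ?_
  · rw [interior_Icc] at hr
    exact (N.hasDerivAt_div S hr.1 hr.2.le).differentiableAt.differentiableWithinAt
  · rw [interior_Icc] at hr
    rw [(N.hasDerivAt_div S hr.1 hr.2.le).deriv]
    have h1 := mul_nonneg N.energy_nonneg (N.integral_nonneg S hr.1.le hr.2.le)
    have := S.pos hr.1.le
    exact div_nonpos_of_nonpos_of_nonneg (by linarith) (by positivity)

lemma le_mul (N : IsRadialNeumann w G G' e L) (S : IsRadialScattering w F F' R) {r : ℝ}
    (hr : 0 ≤ r) (hrL : r ≤ L) : G r ≤ G 0 / F 0 * F r := by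
  have h := N.antitoneOn_div S (Set.left_mem_Icc.2 (hr.trans hrL)) ⟨hr, hrL⟩ hr
  exact (div_le_iff₀ (S.pos hr)).1 h

/-- The ratio `G / F` decreases to its value `1 / F L` at the boundary, which is at least `1`. -/
lemma scattering_le (N : IsRadialNeumann w G G' e L) (S : IsRadialScattering w F F' R) {r : ℝ}
    (hr : 0 ≤ r) (hrL : r ≤ L) : F r ≤ G r := by
  have h := N.antitoneOn_div S ⟨hr, hrL⟩ (Set.right_mem_Icc.2 (hr.trans hrL)) hrL
  simp only [N.eq_one] at h
  have h1 : 1 ≤ 1 / F L := (one_le_div (S.pos (hr.trans hrL))).2 (S.le_one (hr.trans hrL))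
  have := h1.trans h
  rwa [one_le_div (S.pos hr)] at this

/-- The Wronskian identity at `r = L`, where `G = 1`, `G' = 0` and the scattering flux has reached
the scattering length. -/
lemma energy_mul_integral (N : IsRadialNeumann w G G' e L) (S : IsRadialScattering w F F' R)
    (hRL : R ≤ L) : e * ∫ s in (0 : ℝ)..L, G s * F s * s ^ 2 = R ^ 2 * F' R := by
  have h := N.wronskian S (S.radius_pos.le.trans hRL) le_rfl
  rw [N.eq_one, N.deriv_eq_zero, S.flux_eq hRL] at h
  linarith

/-- The energy is bounded by the scattering length. -/
lemma energy_mul_le (N : IsRadialNeumann w G G' e L) (S : IsRadialScattering w F F' R)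
    (hRL : R ≤ L) : e * ((L - R ^ 2 * F' R) ^ 3 / 3) ≤ R ^ 2 * F' R := by
  set a := R ^ 2 * F' R with ha
  have ha0 : 0 ≤ a := S.length_nonneg
  have haL : a ≤ L := S.length_le.trans hRL
  have hF := S.continuous
  have hG := N.continuous
  have hL : 0 ≤ L := ha0.trans haL
  have h1 : ∫ s in a..L, (s - a) ^ 2 = (L - a) ^ 3 / 3 := by
    rw [intervalIntegral.integral_comp_sub_right (fun s => s ^ 2) a, integral_pow]
    norm_num
  -- From `G ≥ F ≥ 1 - a / s`: on `[a, L]` the right side of this bound is nonnegative, so `G F s² ≥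
  -- (1 - a / s)² s² = (s - a)²`.
  have h2 : ∫ s in a..L, (s - a) ^ 2 ≤ ∫ s in a..L, G s * F s * s ^ 2 := by
    refine intervalIntegral.integral_mono_on haL (Continuous.intervalIntegrable (by fun_prop) _ _)
      (Continuous.intervalIntegrable (by fun_prop) _ _) fun s hs => ?_
    rcases (ha0.trans hs.1).eq_or_lt with h0 | h0
    · have : a = 0 := le_antisymm (hs.1.trans h0.ge) ha0
      simp [← h0, this]
    · have e1 := S.one_sub_div_le h0
      have e2 := N.scattering_le S h0.le hs.2
      have e3 : s - a = (1 - a / s) * s := by field_simp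
      have e4 : 0 ≤ 1 - a / s := by
        rw [sub_nonneg, div_le_one h0]; exact hs.1
      rw [e3, mul_pow, sq (1 - a / s)]
      gcongr
      · exact e4.trans (e1.trans e2)
      · exact e1.trans e2
  have h3 : ∫ s in a..L, G s * F s * s ^ 2 ≤ ∫ s in (0 : ℝ)..L, G s * F s * s ^ 2 := by
    have hc : Continuous fun s => G s * F s * s ^ 2 := by fun_prop
    have := intervalIntegral.integral_add_adjacent_intervals
      (hc.intervalIntegrable (μ := volume) 0 a) (hc.intervalIntegrable a L)
    have := N.integral_nonneg S ha0 haL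
    linarith
  calc e * ((L - a) ^ 3 / 3) ≤ e * ∫ s in (0 : ℝ)..L, G s * F s * s ^ 2 := by
        have := N.energy_nonneg
        gcongr
        linarith
    _ = a := N.energy_mul_integral S hRL

/-- Bounds the drop of `G / F`. Since `G ≤ (G 0 / F 0) F` and `F` is increasing, the Wronskian
integral is at most `(G 0 / F 0) F(r)² r³ / 3`; the derivative of the ratio is thus at least `-(e /
3) (G 0 / F 0) r`, which the quadratic term compensates. -/
lemma monotoneOn_div_add (N : IsRadialNeumann w G G' e L) (S : IsRadialScattering w F F' R) :
    MonotoneOn (fun r => G r / F r + e / 6 * (G 0 / F 0) * r ^ 2) (Set.Icc 0 L) := by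
  have hd : ∀ r ∈ interior (Set.Icc 0 L),
      HasDerivAt (fun r => G r / F r + e / 6 * (G 0 / F 0) * r ^ 2)
      (-(e * ∫ s in (0 : ℝ)..r, G s * F s * s ^ 2) / (r ^ 2 * F r ^ 2) +
        e / 6 * (G 0 / F 0) * (2 * r)) r := fun r hr => by
    rw [interior_Icc] at hr
    refine (N.hasDerivAt_div S hr.1 hr.2.le).add ?_
    exact ((hasDerivAt_pow 2 r).const_mul _).congr_deriv (by simp)
  refine monotoneOn_of_deriv_nonneg (convex_Icc 0 L)
    ((N.continuousOn_div S).add (Continuous.continuousOn (by fun_prop)))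
    (fun r hr => (hd r hr).differentiableAt.differentiableWithinAt) fun r hr => ?_
  rw [(hd r hr).deriv]
  rw [interior_Icc] at hr
  have hFr := S.pos hr.1.le
  have hF := S.continuous
  have hG := N.continuous
  have hr0 := hr.1
  have h1 : ∫ s in (0 : ℝ)..r, G s * F s * s ^ 2 ≤
      ∫ s in (0 : ℝ)..r, G 0 / F 0 * F r ^ 2 * s ^ 2 := by
    refine intervalIntegral.integral_mono_on hr.1.le
      (Continuous.intervalIntegrable (by fun_prop) _ _)
      (Continuous.intervalIntegrable (by fun_prop) _ _) fun s hs => ?_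
    have e1 := N.le_mul S hs.1 (hs.2.trans hr.2.le)
    have e2 := S.monotoneOn (Set.mem_Ici.2 hs.1) (Set.mem_Ici.2 hr.1.le) hs.2
    have e3 := S.pos hs.1
    have e4 : 0 < G 0 / F 0 := div_pos (N.pos 0 le_rfl (hr.1.trans hr.2).le) (S.pos le_rfl)
    calc G s * F s * s ^ 2 ≤ (G 0 / F 0 * F s) * F s * s ^ 2 := by gcongr
      _ ≤ (G 0 / F 0 * F r) * F r * s ^ 2 := by gcongr
      _ = _ := by ring
  rw [intervalIntegral.integral_const_mul, integral_pow] at h1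
  norm_num at h1
  have h2 : e * ∫ s in (0 : ℝ)..r, G s * F s * s ^ 2 ≤
      e * (G 0 / F 0 * F r ^ 2 * (r ^ 3 / 3)) := by
    have := N.energy_nonneg
    gcongr
  have h3 : e / 6 * (G 0 / F 0) * (2 * r) =
      e * (G 0 / F 0 * F r ^ 2 * (r ^ 3 / 3)) / (r ^ 2 * F r ^ 2) := by
    field_simp
    ring
  rw [h3, ← add_div]
  exact div_nonneg (by linarith) (by positivity)

lemma ratio_mul_le (N : IsRadialNeumann w G G' e L) (S : IsRadialScattering w F F' R)
    (hL : 0 ≤ L) : G 0 / F 0 * (1 - e / 6 * L ^ 2) ≤ 1 / F L := by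
  have h := N.monotoneOn_div_add S (Set.left_mem_Icc.2 hL) (Set.right_mem_Icc.2 hL) hL
  simp only [N.eq_one] at h
  nlinarith

end IsRadialNeumann

/-! ### Quantitative bounds for large `L` -/

namespace IsRadialNeumann

variable {w F F' G G' : ℝ → ℝ} {R e L : ℝ}

/-- With `t = a / L ≤ 1 / 100`, the bound of `energy_mul_le` carries the factor `(1 - t)⁻³`, which
is at most `1 + 4 t`. -/
lemma energy_le (N : IsRadialNeumann w G G' e L) (S : IsRadialScattering w F F' R)
    (hRL : 100 * R ≤ L) :
    e ≤ 3 * (R ^ 2 * F' R) / L ^ 3 * (1 + 4 * (R ^ 2 * F' R / L)) := by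
  have hR := S.radius_pos
  have hL : 0 < L := by linarith
  have h := N.energy_mul_le S (by linarith)
  have ha0 := S.length_nonneg
  have haR := S.length_le
  set a := R ^ 2 * F' R
  obtain ⟨t, ht⟩ : ∃ t, t = a / L := ⟨_, rfl⟩
  have ht0 : 0 ≤ t := by rw [ht]; positivity
  have ht1 : t ≤ 1 / 100 := by
    rw [ht, div_le_iff₀ hL]; linarith
  have hat : a = t * L := by rw [ht]; field_simp
  rw [← ht]
  have h1 : 1 ≤ (1 - t) ^ 3 * (1 + 4 * t) := by nlinarith [pow_nonneg ht0 3, pow_nonneg ht0 2]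
  have h2 : e * (1 - t) ^ 3 * L ^ 3 ≤ 3 * a := by
    have : (L - a) ^ 3 = (1 - t) ^ 3 * L ^ 3 := by rw [hat]; ring
    rw [this] at h; linarith
  rw [div_mul_eq_mul_div, le_div_iff₀ (by positivity)]
  have he := N.energy_nonneg
  calc e * L ^ 3 ≤ e * L ^ 3 * ((1 - t) ^ 3 * (1 + 4 * t)) := le_mul_of_one_le_right
        (by positivity) h1
    _ = e * (1 - t) ^ 3 * L ^ 3 * (1 + 4 * t) := by ring
    _ ≤ 3 * a * (1 + 4 * t) := by gcongr

/-- To first order in `t = a / L`, the drop of the ratio contributes `t / 2` and `1 / F L = 1 / (1 -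
t)` contributes `t`; the factor `2` leaves room for the higher orders. -/
lemma ratio_le (N : IsRadialNeumann w G G' e L) (S : IsRadialScattering w F F' R)
    (hRL : 100 * R ≤ L) : G 0 / F 0 ≤ 1 + 2 * (R ^ 2 * F' R / L) := by
  have hR := S.radius_pos
  have hL : 0 < L := by linarith
  have h := N.ratio_mul_le S hL.le
  have he := N.energy_le S hRL
  rw [S.eq_one_sub_div (show R ≤ L by linarith)] at h
  have ha0 := S.length_nonneg
  have haR := S.length_le
  have hg : 0 < G 0 / F 0 := div_pos (N.pos 0 le_rfl hL.le) (S.pos le_rfl)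
  set a := R ^ 2 * F' R
  set g := G 0 / F 0
  obtain ⟨t, ht⟩ : ∃ t, t = a / L := ⟨_, rfl⟩
  have ht0 : 0 ≤ t := by rw [ht]; positivity
  have ht1 : t ≤ 1 / 100 := by
    rw [ht, div_le_iff₀ hL]; linarith
  have hat : a = t * L := by rw [ht]; field_simp
  rw [← ht] at h he ⊢
  have h1 : e / 6 * L ^ 2 ≤ t / 2 * (1 + 4 * t) := by
    calc e / 6 * L ^ 2 ≤ (3 * a / L ^ 3 * (1 + 4 * t)) / 6 * L ^ 2 := by gcongr
      _ = t / 2 * (1 + 4 * t) := by rw [hat]; field_simp; ring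
  have h2 : g * (1 - t / 2 * (1 + 4 * t)) ≤ 1 / (1 - t) :=
    le_trans (by gcongr) h
  rw [le_div_iff₀ (by linarith)] at h2
  have h3 : 1 ≤ (1 - t / 2 * (1 + 4 * t)) * (1 - t) * (1 + 2 * t) := by
    nlinarith [pow_nonneg ht0 3, pow_nonneg ht0 2, pow_nonneg ht0 4]
  calc g ≤ g * ((1 - t / 2 * (1 + 4 * t)) * (1 - t) * (1 + 2 * t)) :=
        le_mul_of_one_le_right hg.le h3
    _ = g * (1 - t / 2 * (1 + 4 * t)) * (1 - t) * (1 + 2 * t) := by ring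
    _ ≤ 1 * (1 + 2 * t) := by gcongr
    _ = _ := one_mul _

/-- Outside the support the flux of `G` has density `-e G s² ≤ 0`, and it ends at `0` at `r = L`. -/
lemma flux_nonneg (N : IsRadialNeumann w G G' e L) (S : IsRadialScattering w F F' R) {r : ℝ}
    (hr : R ≤ r) (hrL : r ≤ L) : 0 ≤ G' r := by
  have hr0 : 0 < r := S.radius_pos.trans_le hr
  have hi := intervalIntegrable (e := e) S (N.continuous.mul (continuous_pow 2))
  have h1 := N.flux r hr0.le hrL
  have h2 := N.flux L (hr0.le.trans hrL) le_rfl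
  have h3 := intervalIntegral.integral_interval_sub_left (hi 0 L) (hi 0 r)
  simp only [Pi.mul_apply] at h3
  rw [← h1, ← h2, N.deriv_eq_zero] at h3
  have h4 : ∫ s in r..L, (w s - e) * (G s * s ^ 2) ≤ 0 := by
    rw [intervalIntegral.integral_of_le hrL]
    refine setIntegral_nonpos measurableSet_Ioc fun s hs => ?_
    rw [S.eq_zero s (hr.trans_lt hs.1), zero_sub, neg_mul, neg_nonpos]
    have := N.pos s (hr0.trans hs.1).le hs.2
    have := N.energy_nonneg
    positivity
  exact nonneg_of_mul_nonneg_right (by linarith : 0 ≤ r ^ 2 * G' r) (by positivity)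

lemma le_one (N : IsRadialNeumann w G G' e L) (S : IsRadialScattering w F F' R)
    (hRL : 100 * R ≤ L) {r : ℝ} (hr : 0 ≤ r) (hrL : r ≤ L) : G r ≤ 1 := by
  have hR := S.radius_pos
  have hL : 0 < L := by linarith
  rcases le_total R r with h | h
  · have hm : MonotoneOn G (Set.Icc R L) := by
      refine monotoneOn_of_deriv_nonneg (convex_Icc R L) N.continuous.continuousOn
        (fun r _ => (N.hasDerivAt r).differentiableAt.differentiableWithinAt) fun s hs => ?_
      rw [(N.hasDerivAt s).deriv]
      have hs' := interior_subset hs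
      exact N.flux_nonneg S hs'.1 hs'.2
    rw [← N.eq_one]
    exact hm ⟨h, hrL⟩ ⟨by linarith, le_rfl⟩ hrL
  -- Inside the support `G ≤ (1 + 2a/L) F R = (1 + 2a/L) (1 - a/R)`; as `L ≥ 100 R`, the gain `2a/L`
  -- is smaller than the loss `a/R`.
  · have h1 := N.le_mul S hr hrL
    have h2 := N.ratio_le S hRL
    have h3 := S.monotoneOn (Set.mem_Ici.2 hr) (Set.mem_Ici.2 hR.le) h
    rw [S.eq_one_sub_div le_rfl] at h3
    have ha0 := S.length_nonneg
    have haR := S.length_le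
    have hF := S.pos hr
    set a := R ^ 2 * F' R
    have h4 : a / L ≤ a / R / 100 := by
      rw [div_div]; gcongr; linarith
    have h5 : 0 ≤ a / R := by positivity
    have h6 : 0 ≤ a / L := by positivity
    have h7 : a / R ≤ 1 := (div_le_one hR).2 haR
    calc G r ≤ (1 + 2 * (a / L)) * (1 - a / R) := h1.trans (by gcongr)
      _ ≤ (1 + 2 * (a / R / 100)) * (1 - a / R) := by gcongr
      _ ≤ 1 := by nlinarith

/-- The Wronskian is nonpositive, so `G' F ≤ F' G`, and `G ≤ (G 0 / F 0) F`. -/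
lemma deriv_le (N : IsRadialNeumann w G G' e L) (S : IsRadialScattering w F F' R) {r : ℝ}
    (hr : 0 < r) (hrL : r ≤ L) : G' r ≤ G 0 / F 0 * F' r := by
  have h1 := N.wronskian S hr.le hrL
  have h2 := mul_nonneg N.energy_nonneg (N.integral_nonneg S hr.le hrL)
  have h3 := N.le_mul S hr.le hrL
  have hF := S.pos hr.le
  have h4 : 0 ≤ F' r := nonneg_of_mul_nonneg_right (S.flux_nonneg hr.le) (by positivity)
  have h5 : r ^ 2 * (G' r * F r) ≤ r ^ 2 * (F' r * G r) := by nlinarith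
  have h6 := le_of_mul_le_mul_left h5 (by positivity)
  have h7 : G' r * F r ≤ (G 0 / F 0 * F' r) * F r := by nlinarith
  exact le_of_mul_le_mul_right h7 hF

/-- The potential only increases the flux, so a negative `G'` is due to the energy alone: `-r² G' ≤
e r³ / 3`, with `e ≤ 6 a / L³`. -/
lemma neg_deriv_le (N : IsRadialNeumann w G G' e L) (S : IsRadialScattering w F F' R)
    (hRL : 100 * R ≤ L) {r : ℝ} (hr : 0 < r) (hrR : r ≤ R) :
    -G' r ≤ 2 * (R ^ 2 * F' R) * r / L ^ 3 := by
  have hR := S.radius_pos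
  have hL : 0 < L := by linarith
  have hrL : r ≤ L := by linarith
  have hG := N.continuous
  have he := N.energy_nonneg
  have h1 : -(r ^ 2 * G' r) ≤ e * (r ^ 3 / 3) := by
    have h2 : ∫ s in (0 : ℝ)..r, -((w s - e) * (G s * s ^ 2)) ≤ ∫ s in (0 : ℝ)..r, e * s ^ 2 := by
      refine intervalIntegral.integral_mono_on hr.le
        (intervalIntegrable S (by fun_prop) _ _).neg
        (Continuous.intervalIntegrable (by fun_prop) _ _) fun s hs => ?_
      have h3 := N.le_one S hRL hs.1 (hs.2.trans hrL)
      have h4 := N.pos s hs.1 (hs.2.trans hrL)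
      have h5 := S.nonneg s
      calc -((w s - e) * (G s * s ^ 2)) = e * (G s * s ^ 2) - w s * (G s * s ^ 2) := by ring
        _ ≤ e * (G s * s ^ 2) := sub_le_self _ (by positivity)
        _ ≤ e * (1 * s ^ 2) := by gcongr
        _ = e * s ^ 2 := by ring
    rw [intervalIntegral.integral_neg, ← N.flux r hr.le hrL, intervalIntegral.integral_const_mul,
      integral_pow] at h2
    norm_num at h2
    linarith
  have h2 : -G' r ≤ e * (r / 3) := by
    have : r ^ 2 * -G' r ≤ r ^ 2 * (e * (r / 3)) := by nlinarith
    exact le_of_mul_le_mul_left this (by positivity)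
  have h3 := N.energy_le S hRL
  have ha0 := S.length_nonneg
  have haR := S.length_le
  set a := R ^ 2 * F' R
  have h4 : a / L ≤ 1 / 100 := by rw [div_le_iff₀ hL]; linarith
  calc -G' r ≤ (3 * a / L ^ 3 * (1 + 4 * (a / L))) * (r / 3) := h2.trans (by gcongr)
    _ ≤ (3 * a / L ^ 3 * 2) * (r / 3) := by gcongr; linarith
    _ = _ := by ring

lemma abs_deriv_le_div_sq (N : IsRadialNeumann w G G' e L) (S : IsRadialScattering w F F' R)
    (hRL : 100 * R ≤ L) {r : ℝ} (hr : 0 < r) (hrL : r ≤ L) :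
    |G' r| ≤ R ^ 2 * F' R * (1 + 2 * (R / L)) / r ^ 2 := by
  have hR := S.radius_pos
  have hL : 0 < L := by linarith
  have h1 := N.deriv_le S hr hrL
  have h2 := N.ratio_le S hRL
  have h3 := S.flux_le hr.le
  have ha0 := S.length_nonneg
  have haR := S.length_le
  have hF' : 0 ≤ F' r := nonneg_of_mul_nonneg_right (S.flux_nonneg hr.le) (by positivity)
  set a := R ^ 2 * F' R
  have h4 : a / L ≤ R / L := by gcongr
  rw [abs_le', le_div_iff₀ (by positivity), le_div_iff₀ (by positivity)]
  constructor
  · calc G' r * r ^ 2 ≤ ((1 + 2 * (a / L)) * F' r) * r ^ 2 := by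
          gcongr; exact h1.trans (by gcongr)
      _ = (1 + 2 * (a / L)) * (r ^ 2 * F' r) := by ring
      _ ≤ (1 + 2 * (R / L)) * a := by gcongr
      _ = _ := by ring
  · rcases le_total R r with h | h
    · have h5 := N.flux_nonneg S h hrL
      have : 0 ≤ a * (1 + 2 * (R / L)) := by positivity
      nlinarith [sq_nonneg r]
    · have h5 := N.neg_deriv_le S hRL hr h
      calc -G' r * r ^ 2 ≤ (2 * a * r / L ^ 3) * r ^ 2 := by gcongr
        _ = a * (2 * (r ^ 3 / L ^ 3)) := by ring
        _ ≤ a * (1 + 2 * (R / L)) := by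
          gcongr
          have e1 : r ^ 3 / L ^ 3 ≤ R / L := by
            rw [← div_pow]
            have e2 : r / L ≤ R / L := by gcongr
            have e3 : 0 ≤ r / L := by positivity
            have e4 : r / L ≤ 1 := (div_le_one hL).2 hrL
            calc (r / L) ^ 3 ≤ r / L := pow_le_of_le_one e3 e4 (by norm_num)
              _ ≤ _ := e2
          linarith

lemma abs_deriv_le_div (N : IsRadialNeumann w G G' e L) (S : IsRadialScattering w F F' R)
    (hRL : 100 * R ≤ L) {r : ℝ} (hr : 0 < r) (hrL : r ≤ L) : |G' r| ≤ 2 / r := by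
  have hR := S.radius_pos
  have hL : 0 < L := by linarith
  have h1 := N.deriv_le S hr hrL
  have h2 := N.ratio_le S hRL
  have h3 := S.mul_deriv_le hr
  have ha0 := S.length_nonneg
  have haR := S.length_le
  have hF' : 0 ≤ F' r := nonneg_of_mul_nonneg_right (S.flux_nonneg hr.le) (by positivity)
  set a := R ^ 2 * F' R
  have h4 : a / L ≤ 1 / 100 := by rw [div_le_iff₀ hL]; linarith
  rw [abs_le', le_div_iff₀ hr, le_div_iff₀ hr]
  constructor
  · calc G' r * r ≤ (2 * F' r) * r := by
          gcongr; exact h1.trans (by gcongr; linarith)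
      _ = 2 * (r * F' r) := by ring
      _ ≤ 2 * 1 := by gcongr
      _ = 2 := by norm_num
  · rcases le_total R r with h | h
    · have h5 := N.flux_nonneg S h hrL
      nlinarith
    · have h5 := N.neg_deriv_le S hRL hr h
      calc -G' r * r ≤ (2 * a * r / L ^ 3) * r := by gcongr
        _ ≤ (2 * L * L / L ^ 3) * L := by gcongr; linarith
        _ = 2 := by field_simp

/-- For `r ≤ R` the flux is at most `K F(r) r³ / 3`, and `F r ≤ F R = (R - a) / R`. Beyond `R` the
flux is constant, so the bound at `R` persists. -/
lemma _root_.IsRadialScattering.deriv_le (S : IsRadialScattering w F F' R) {K : ℝ}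
    (hK0 : 0 ≤ K) (hK : ∀ᵐ s, 0 < s → w s ≤ K) {r : ℝ} (hr : 0 < r) :
    F' r ≤ K * (R - R ^ 2 * F' R) / 3 := by
  have hR := S.radius_pos
  have haR := S.length_le
  have hFR := S.eq_one_sub_div (le_refl R)
  rcases le_total r R with h | h
  · have h1 := S.flux_le_of_ae_le hK hr.le
    have h2 := S.monotoneOn (Set.mem_Ici.2 hr.le) (Set.mem_Ici.2 hR.le) h
    have h3 := S.pos hr.le
    rw [hFR] at h2
    set a := R ^ 2 * F' R
    have h4 : r ^ 2 * F' r ≤ r ^ 2 * (K * F r * r / 3) := by nlinarith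
    have h5 := le_of_mul_le_mul_left h4 (by positivity)
    calc F' r ≤ K * (1 - a / R) * R / 3 := by
          have : 0 ≤ K * (1 - a / R) := mul_nonneg hK0 (h3.le.trans h2)
          exact h5.trans (by gcongr)
      _ = _ := by field_simp
  · have h1 := S.flux_le_of_ae_le hK hR.le
    rw [hFR] at h1
    have h2 := S.flux_eq h
    set a := R ^ 2 * F' R
    have h3 : K * (1 - a / R) * R ^ 3 / 3 = R ^ 2 * (K * (R - a) / 3) := by field_simp
    have h4 : 0 ≤ K * (R - a) / 3 := by
      have := sub_nonneg.2 haR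
      positivity
    have h5 : r ^ 2 * F' r ≤ r ^ 2 * (K * (R - a) / 3) := by
      rw [h2]
      refine h1.trans (h3.le.trans ?_)
      gcongr
    exact le_of_mul_le_mul_left h5 (by positivity)

/-- For `r ≥ R₀` the flux bound `a` decides, for `r ≤ R₀` the bound `K (R - a) / 3`. Two radii are
kept because only the true support radius `R` is controlled by the capacity, while the estimate is
stated with `R₀ ≥ R`. -/
lemma abs_deriv_le_of_ae_le (N : IsRadialNeumann w G G' e L) (S : IsRadialScattering w F F' R)
    {R₀ K : ℝ} (hR₀ : R ≤ R₀) (hRL : 100 * R₀ ≤ L) (hK0 : 0 ≤ K)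
    (hK : ∀ᵐ s, 0 < s → w s ≤ K) {r : ℝ} (hr : 0 < r) (hrL : r ≤ L) :
    |G' r| ≤ 4 / (r ^ 2 + R₀ ^ 2) * (R ^ 2 * F' R + (R - R ^ 2 * F' R) * (K * R₀ ^ 2)) := by
  have hR := S.radius_pos
  have hL : 0 < L := by linarith
  have hRL' : 100 * R ≤ L := by linarith
  have h1 := N.deriv_le S hr hrL
  have h2 := N.ratio_le S hRL'
  have ha0 := S.length_nonneg
  have haR := S.length_le
  have hF' : 0 ≤ F' r := nonneg_of_mul_nonneg_right (S.flux_nonneg hr.le) (by positivity)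
  have hflux := S.flux_le hr.le
  have hFK := S.deriv_le hK0 hK hr
  have hneg : r ≤ R → -G' r ≤ _ := N.neg_deriv_le S hRL' hr
  set a := R ^ 2 * F' R
  have h4 : a / L ≤ 1 / 100 := by rw [div_le_iff₀ hL]; linarith
  have h5 : 0 ≤ (R - a) * (K * R₀ ^ 2) := by
    have := sub_nonneg.2 haR
    positivity
  have h6 : G' r ≤ 2 * F' r := h1.trans (by gcongr; linarith)
  have hR₀0 : 0 < R₀ := hR.trans_le hR₀
  rw [div_mul_eq_mul_div, abs_le', le_div_iff₀ (by positivity), le_div_iff₀ (by positivity)]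
  constructor
  · rcases le_total R₀ r with h | h
    · calc G' r * (r ^ 2 + R₀ ^ 2) ≤ (2 * F' r) * (r ^ 2 + r ^ 2) := by gcongr
        _ = 4 * (r ^ 2 * F' r) := by ring
        _ ≤ 4 * (a + (R - a) * (K * R₀ ^ 2)) := by gcongr; linarith
    · calc G' r * (r ^ 2 + R₀ ^ 2) ≤ (2 * (K * (R - a) / 3)) * (R₀ ^ 2 + R₀ ^ 2) := by
            have : 0 ≤ K * (R - a) / 3 := hF'.trans hFK
            gcongr
            linarith
        _ = 4 / 3 * ((R - a) * (K * R₀ ^ 2)) := by ring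
        _ ≤ 4 * (a + (R - a) * (K * R₀ ^ 2)) := by linarith
  · rcases le_total R r with h | h
    · have h7 := N.flux_nonneg S h hrL
      have : 0 ≤ a + (R - a) * (K * R₀ ^ 2) := by linarith
      nlinarith [sq_nonneg r, sq_nonneg R₀]
    · calc -G' r * (r ^ 2 + R₀ ^ 2) ≤ (2 * a * r / L ^ 3) * (r ^ 2 + R₀ ^ 2) := by
            gcongr; exact hneg h
        _ ≤ (2 * a * L / L ^ 3) * (L ^ 2 + L ^ 2) := by gcongr; linarith
        _ = 4 * a := by field_simp; ring
        _ ≤ 4 * (a + (R - a) * (K * R₀ ^ 2)) := by linarith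

/-- The factor `F r` is kept on the right: integrated against `v` it yields another scattering
length. -/
lemma abs_sub_le (N : IsRadialNeumann w G G' e L) (S : IsRadialScattering w F F' R)
    (hRL : 100 * R ≤ L) {r : ℝ} (hr : 0 ≤ r) (hrL : r ≤ L) :
    |F r - G r| ≤ 2 * (R ^ 2 * F' R / L) * F r := by
  have h1 := N.scattering_le S hr hrL
  have h2 := N.le_mul S hr hrL
  have h3 := N.ratio_le S hRL
  have hF := S.pos hr
  rw [abs_sub_comm, abs_of_nonneg (by linarith)]
  nlinarith

end IsRadialNeumann

/-! ### The weak maximum principle -/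

lemma gradient_eq_smul_of_fderiv {f g : E3 → ℝ} {x : E3} {c : ℝ}
    (h : fderiv ℝ f x = c • fderiv ℝ g x) : ∇ f x = c • ∇ g x := by
  simp [gradient, h]

lemma norm_gradient_eq (f : E3 → ℝ) (x : E3) : ‖∇ f x‖ = ‖fderiv ℝ f x‖ := by
  simp [gradient]

lemma continuous_gradient {f : E3 → ℝ} (hf : ContDiff ℝ 1 f) : Continuous (∇ f) :=
  (InnerProductSpace.toDual ℝ E3).symm.continuous.comp (hf.continuous_fderiv one_ne_zero)

/-- Test functions must be `C¹`, which the positive part is not; its square is. -/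
lemma hasDerivAt_sq_max_zero (t : ℝ) : HasDerivAt (fun t : ℝ => max t 0 ^ 2) (2 * max t 0) t := by
  rcases lt_trichotomy t 0 with h | rfl | h
  · have : (fun t : ℝ => max t 0 ^ 2) =ᶠ[𝓝 t] fun _ => 0 := by
      filter_upwards [Iio_mem_nhds h] with s hs
      simp [max_eq_right (Set.mem_Iio.1 hs).le]
    rw [max_eq_right h.le, mul_zero]
    exact (hasDerivAt_const t (0 : ℝ)).congr_of_eventuallyEq this
  · rw [hasDerivAt_iff_isLittleO_nhds_zero]
    simp only [zero_add, max_self, mul_zero, smul_zero, sub_zero, ne_eq, OfNat.ofNat_ne_zero,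
      not_false_eq_true, zero_pow]
    have h1 : (fun h : ℝ => max h 0 ^ 2) =O[𝓝 0] fun h : ℝ => h ^ 2 := by
      refine Asymptotics.isBigO_of_le _ fun h => ?_
      rw [norm_pow, norm_pow]
      gcongr
      rcases le_total h 0 with h' | h' <;> simp [h']
    exact h1.trans_isLittleO (by simpa using Asymptotics.isLittleO_pow_pow (𝕜 := ℝ) one_lt_two)
  · have : (fun t : ℝ => max t 0 ^ 2) =ᶠ[𝓝 t] fun s => s ^ 2 := by
      filter_upwards [Ioi_mem_nhds h] with s hs
      simp [max_eq_left (Set.mem_Ioi.1 hs).le]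
    rw [max_eq_left h.le]
    simpa using (hasDerivAt_pow 2 t).congr_of_eventuallyEq this

/-- The square of the positive part is `C¹`. -/
lemma contDiff_sq_max_zero : ContDiff ℝ 1 (fun t : ℝ => max t 0 ^ 2) := by
  rw [contDiff_one_iff_deriv]
  refine ⟨fun t => (hasDerivAt_sq_max_zero t).differentiableAt, ?_⟩
  rw [funext fun t => (hasDerivAt_sq_max_zero t).deriv]
  fun_prop

/-- Weak solutions of `(-μ Δ + v) w = 0` on the whole space. -/
def IsWeakSolution (μ : ℝ) (v w : E3 → ℝ) : Prop :=
  ∀ φ : E3 → ℝ, ContDiff ℝ 1 φ → HasCompactSupport φ →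
    ∫ x, (μ * inner ℝ (∇ w x) (∇ φ x) + v x * w x * φ x) = 0

lemma integrable_bdd_mul_of_hasCompactSupport {v h : E3 → ℝ} {B : ℝ} (hv : Measurable v)
    (hB : ∀ x, |v x| ≤ B) (hh : Continuous h) (hc : HasCompactSupport h) :
    Integrable (fun x => v x * h x) :=
  (hh.integrable_of_hasCompactSupport hc).bdd_mul hv.aestronglyMeasurable (Eventually.of_forall hB)

lemma hasCompactSupport_gradient {φ : E3 → ℝ} (h : HasCompactSupport φ) :
    HasCompactSupport (∇ φ) := by
  have h1 := h.fderiv (𝕜 := ℝ)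
  exact h1.comp_left (g := (InnerProductSpace.toDual ℝ E3).symm) (map_zero _)

/-- The weak maximum principle. -/
lemma IsWeakSolution.le_of_eventually_lt {μ : ℝ} {v w : E3 → ℝ} (hμ : 0 < μ) (hv : Measurable v)
    (hv0 : ∀ x, 0 ≤ v x) (hvB : ∃ M, ∀ x, v x ≤ M) (hw : ContDiff ℝ 1 w)
    (h : IsWeakSolution μ v w) {a : ℝ} (ha : 0 ≤ a) (hlt : ∀ᶠ x in cocompact E3, w x < a)
    (x : E3) : w x ≤ a := by
  obtain ⟨B, hB⟩ := hvB
  set φ : E3 → ℝ := fun x => max (w x - a) 0 ^ 2 with hφ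
  have hφ1 : ContDiff ℝ 1 φ := contDiff_sq_max_zero.comp (hw.sub contDiff_const)
  obtain ⟨K, hK, hKw⟩ := mem_cocompact.1 hlt
  have hφc : HasCompactSupport φ := by
    refine HasCompactSupport.intro hK fun x hx => ?_
    have : w x < a := hKw hx
    simp only [hφ]
    rw [max_eq_right (by linarith)]
    simp
  have hgrad : ∀ x, ∇ φ x = (2 * max (w x - a) 0) • ∇ w x := fun x => by
    refine gradient_eq_smul_of_fderiv (HasFDerivAt.fderiv ?_)
    exact (hasDerivAt_sq_max_zero (w x - a)).comp_hasFDerivAt x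
      (((hw.differentiable one_ne_zero x).hasFDerivAt).sub_const a)
  have hw' := continuous_gradient hw
  have hφ' := continuous_gradient hφ1
  have hwc := hw.continuous
  have hint1 : Integrable fun x => μ * inner ℝ (∇ w x) (∇ φ x) := by
    refine Integrable.const_mul (Continuous.integrable_of_hasCompactSupport (by fun_prop) ?_) μ
    exact (hasCompactSupport_gradient hφc).mono' (fun x hx => subset_tsupport _ fun h0 => hx (by
      simp only [h0, inner_zero_right]))
  have hint2 : Integrable fun x => v x * w x * φ x := by
    simp_rw [mul_assoc]
    refine integrable_bdd_mul_of_hasCompactSupport hv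
      (fun x => by rw [abs_of_nonneg (hv0 x)]; exact hB x) (hwc.mul hφ1.continuous) ?_
    exact hφc.mul_left
  have hp1 : ∀ x, 0 ≤ μ * inner ℝ (∇ w x) (∇ φ x) := fun x => by
    rw [hgrad, inner_smul_right, real_inner_self_eq_norm_sq]
    positivity
  have hp2 : ∀ x, 0 ≤ v x * w x * φ x := fun x => by
    rcases le_total (w x) a with h1 | h1
    · simp [hφ, max_eq_right (sub_nonpos.2 h1)]
    · have := hv0 x
      have := ha.trans h1
      positivity
  -- Both parts of the tested equation have nonnegative integrands, so each integral vanishes.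
  -- Continuity then gives `∇ φ = 0` everywhere, and `φ` is a constant that is zero far out.
  have hz := h φ hφ1 hφc
  rw [integral_add hint1 hint2] at hz
  have hz1 : ∫ x, μ * inner ℝ (∇ w x) (∇ φ x) = 0 :=
    le_antisymm (by linarith [integral_nonneg (μ := volume) (f := fun x => v x * w x * φ x) hp2])
      (integral_nonneg hp1)
  have hz2 : (fun x => μ * inner ℝ (∇ w x) (∇ φ x)) = 0 :=
    (Continuous.ae_eq_iff_eq volume (by fun_prop) continuous_zero).1
      ((integral_eq_zero_iff_of_nonneg hp1 hint1).1 hz1)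
  have hz3 : ∀ x, fderiv ℝ φ x = 0 := fun x => by
    have h1 : μ * inner ℝ (∇ w x) (∇ φ x) = 0 := congrFun hz2 x
    rw [ hgrad, inner_smul_right, real_inner_self_eq_norm_sq] at h1
    have h2 : ∇ φ x = 0 := by
      rw [hgrad]
      rcases mul_eq_zero.1 h1 with h1 | h1
      · exact absurd h1 hμ.ne'
      · rcases mul_eq_zero.1 h1 with h1 | h1
        · rw [h1, zero_smul]
        · rw [norm_eq_zero.1 (pow_eq_zero_iff two_ne_zero |>.1 h1), smul_zero]
    rw [← toDual_gradient (𝕜 := ℝ), h2, map_zero]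
  have hconst : ∀ y, φ x = φ y := fun y =>
    is_const_of_fderiv_eq_zero (hφ1.differentiable one_ne_zero) hz3 x y
  obtain ⟨y, hy⟩ := hlt.exists
  have h0 := hconst y
  simp only [hφ] at h0
  rw [max_eq_right (by linarith : w y - a ≤ 0)] at h0
  have h1 : max (w x - a) 0 = 0 := by simpa using h0
  linarith [le_max_left (w x - a) 0]

/-! ### Uniqueness and radial symmetry -/

lemma gradient_comp_isometry {f : E3 → ℝ} (hf : Differentiable ℝ f) (T : E3 ≃ₗᵢ[ℝ] E3) (x : E3) :
    ∇ (fun y => f (T y)) x = T.symm (∇ f (T x)) := by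
  have h : HasFDerivAt (fun y => f (T y))
      ((fderiv ℝ f (T x)).comp (T.toContinuousLinearEquiv : E3 →L[ℝ] E3)) x :=
    (hf (T x)).hasFDerivAt.comp x T.toContinuousLinearEquiv.hasFDerivAt
  refine ext_inner_right ℝ fun y => ?_
  rw [inner_gradient_left, h.fderiv, ← T.inner_map_map, T.apply_symm_apply, inner_gradient_left]
  rfl

lemma inner_gradient_comp_isometry {f g : E3 → ℝ} (hf : Differentiable ℝ f)
    (hg : Differentiable ℝ g) (T : E3 ≃ₗᵢ[ℝ] E3) (x : E3) :
    inner ℝ (∇ (fun y => f (T y)) x) (∇ g x) =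
      inner ℝ (∇ f (T x)) (∇ (fun y => g (T.symm y)) (T x)) := by
  rw [gradient_comp_isometry hf, gradient_comp_isometry hg T.symm, ← T.inner_map_map]
  simp

lemma exists_isometry_of_norm_eq {x y : E3} (h : ‖x‖ = ‖y‖) : ∃ T : E3 ≃ₗᵢ[ℝ] E3, T x = y :=
  ⟨_, Submodule.reflection_sub h⟩

lemma IsScatteringSolution.comp_isometry {μ : ℝ} {v f : E3 → ℝ}
    (hv : ∀ x y, ‖x‖ = ‖y‖ → v x = v y) (h : IsScatteringSolution μ v f) (T : E3 ≃ₗᵢ[ℝ] E3) :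
    IsScatteringSolution μ v (fun x => f (T x)) where
  contDiff := h.contDiff.comp T.contDiff
  equation φ hφ hφc := by
    have h1 := h.equation (fun y => φ (T.symm y)) (hφ.comp T.symm.contDiff)
      (hφc.comp_homeomorph T.symm.toHomeomorph)
    rw [← h1, ← T.measurePreserving.integral_comp T.toHomeomorph.measurableEmbedding
      fun y => μ * inner ℝ (∇ f y) (∇ (fun y => φ (T.symm y)) y) + v y * f y * φ (T.symm y)]
    refine integral_congr_ae (Eventually.of_forall fun x => ?_)
    simp only
    rw [inner_gradient_comp_isometry (h.contDiff.differentiable one_ne_zero)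
      (hφ.differentiable one_ne_zero), hv x (T x) (T.norm_map x).symm, T.symm_apply_apply]
  tendsto_one := h.tendsto_one.comp T.toHomeomorph.isClosedEmbedding.tendsto_cocompact

lemma IsNeumannGroundState.comp_isometry {μ L : ℝ} {v f : E3 → ℝ}
    (hv : ∀ x y, ‖x‖ = ‖y‖ → v x = v y) (h : IsNeumannGroundState μ v L f)
    (T : E3 ≃ₗᵢ[ℝ] E3) : IsNeumannGroundState μ v L (fun x => f (T x)) where
  contDiff := h.contDiff.comp T.contDiff
  pos x hx := h.pos _ (by rwa [T.norm_map])
  equation φ hφ := by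
    have h1 := h.equation (fun y => φ (T.symm y)) (hφ.comp T.symm.contDiff)
    have hpre : T ⁻¹' Metric.closedBall 0 L = Metric.closedBall 0 L := by
      ext x; simp
    rw [← T.measurePreserving.setIntegral_preimage_emb T.toHomeomorph.measurableEmbedding
        (fun y => μ * inner ℝ (∇ f y) (∇ (fun y => φ (T.symm y)) y) + v y * f y * φ (T.symm y)),
      ← T.measurePreserving.setIntegral_preimage_emb T.toHomeomorph.measurableEmbedding
        (fun y => f y * φ (T.symm y)), hpre] at h1
    simp only [T.symm_apply_apply] at h1
    rw [← h1]
    refine integral_congr_ae (Eventually.of_forall fun x => ?_)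
    simp only
    rw [inner_gradient_comp_isometry (h.contDiff.differentiable one_ne_zero)
      (hφ.differentiable one_ne_zero), hv x (T x) (T.norm_map x).symm]
  eq_one x hx := h.eq_one _ (by rwa [T.norm_map])
  radial_deriv x hx := by
    have h1 : HasFDerivAt (fun y => f (T y))
        ((fderiv ℝ f (T x)).comp (T.toContinuousLinearEquiv : E3 →L[ℝ] E3)) x :=
      ((h.contDiff.differentiable one_ne_zero) (T x)).hasFDerivAt.comp x
        T.toContinuousLinearEquiv.hasFDerivAt
    rw [h1.fderiv]
    exact h.radial_deriv (T x) (by rwa [T.norm_map])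

lemma integrable_weak_form {μ B : ℝ} {v f φ : E3 → ℝ} (hv : Measurable v)
    (hB : ∀ x, |v x| ≤ B) (hf : ContDiff ℝ 1 f) (hφ : ContDiff ℝ 1 φ) (hc : HasCompactSupport φ) :
    Integrable fun x => μ * inner ℝ (∇ f x) (∇ φ x) + v x * f x * φ x := by
  have hf' := continuous_gradient hf
  have hφ' := continuous_gradient hφ
  refine Integrable.add (Integrable.const_mul
    (Continuous.integrable_of_hasCompactSupport (by fun_prop) ?_) μ) ?_
  · exact (hasCompactSupport_gradient hc).mono' (fun x hx => subset_tsupport _ fun h0 => hx (by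
      simp only [h0, inner_zero_right]))
  · simp_rw [mul_assoc]
    exact integrable_bdd_mul_of_hasCompactSupport hv hB (hf.continuous.mul hφ.continuous)
      hc.mul_left

lemma gradient_sub_apply {f g : E3 → ℝ} (hf : Differentiable ℝ f) (hg : Differentiable ℝ g)
    (x : E3) : ∇ (fun y => f y - g y) x = ∇ f x - ∇ g x := by
  simp only [gradient]
  rw [fderiv_fun_sub (hf x) (hg x), map_sub]

/-- The difference is a weak solution tending to `0`, hence eventually below every `ε > 0`.
Exchanging the two solutions gives uniqueness. -/
lemma IsScatteringSolution.le_of {μ : ℝ} {v f g : E3 → ℝ} (hμ : 0 < μ) (hv : Measurable v)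
    (hv0 : ∀ x, 0 ≤ v x) (hvB : ∃ M, ∀ x, v x ≤ M) (hf : IsScatteringSolution μ v f)
    (hg : IsScatteringSolution μ v g) (x : E3) : f x ≤ g x := by
  have hB := hvB
  obtain ⟨B, hB⟩ := hB
  have hB' : ∀ x, |v x| ≤ B := fun x => by rw [abs_of_nonneg (hv0 x)]; exact hB x
  have hw : IsWeakSolution μ v (fun x => f x - g x) := fun φ hφ hc => by
    have h1 := integral_sub (integrable_weak_form (μ := μ) hv hB' hf.contDiff hφ hc)
      (integrable_weak_form (μ := μ) hv hB' hg.contDiff hφ hc)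
    rw [hf.equation φ hφ hc, hg.equation φ hφ hc, sub_zero] at h1
    rw [← h1]
    refine integral_congr_ae (Eventually.of_forall fun x => ?_)
    simp only
    rw [gradient_sub_apply (hf.contDiff.differentiable one_ne_zero)
      (hg.contDiff.differentiable one_ne_zero), inner_sub_left]
    ring
  refine le_of_forall_pos_le_add fun ε hε => ?_
  have ht : Tendsto (fun x => f x - g x) (cocompact E3) (𝓝 0) := by
    simpa using hf.tendsto_one.sub hg.tendsto_one
  have := hw.le_of_eventually_lt hμ hv hv0 hvB (hf.contDiff.sub hg.contDiff) hε.le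
    (ht.eventually_lt_const hε) x
  linarith

lemma IsScatteringSolution.radial {μ : ℝ} {v f : E3 → ℝ} (hμ : 0 < μ) (hv : Measurable v)
    (hv0 : ∀ x, 0 ≤ v x) (hvB : ∃ M, ∀ x, v x ≤ M) (hrad : ∀ x y, ‖x‖ = ‖y‖ → v x = v y)
    (hf : IsScatteringSolution μ v f) {x y : E3} (h : ‖x‖ = ‖y‖) : f x = f y := by
  obtain ⟨T, rfl⟩ := exists_isometry_of_norm_eq h
  exact le_antisymm (hf.le_of hμ hv hv0 hvB (hf.comp_isometry hrad T) x)
    ((hf.comp_isometry hrad T).le_of hμ hv hv0 hvB hf x)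

lemma IsScatteringSolution.nonneg {μ : ℝ} {v f : E3 → ℝ} (hμ : 0 < μ) (hv : Measurable v)
    (hv0 : ∀ x, 0 ≤ v x) (hvB : ∃ M, ∀ x, v x ≤ M) (hf : IsScatteringSolution μ v f) (x : E3) :
    0 ≤ f x := by
  have hw : IsWeakSolution μ v (fun x => -f x) := fun φ hφ hc => by
    have h1 := congrArg Neg.neg (hf.equation φ hφ hc)
    rw [← integral_neg, neg_zero] at h1
    rw [← h1]
    refine integral_congr_ae (Eventually.of_forall fun x => ?_)
    have : ∇ (fun x => -f x) x = -∇ f x := by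
      simp only [gradient]
      rw [fderiv_fun_neg, map_neg]
    simp only
    rw [this, inner_neg_left]
    ring
  have := hw.le_of_eventually_lt hμ hv hv0 hvB hf.contDiff.neg le_rfl
    ((by simpa using hf.tendsto_one.neg : Tendsto (fun x => -f x) (cocompact E3)
      (𝓝 (-1))).eventually_lt_const (by norm_num)) x
  linarith

lemma eq_zero_of_setIntegral_closedBall_eq_zero {k : E3 → ℝ} {L : ℝ} (hL : 0 < L)
    (hk : Continuous k) (hk0 : ∀ x, 0 ≤ k x) (h : ∫ x in Metric.closedBall 0 L, k x = 0)
    {x : E3} (hx : x ∈ Metric.closedBall 0 L) : k x = 0 := by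
  have hi : IntegrableOn k (Metric.closedBall 0 L) :=
    hk.continuousOn.integrableOn_compact (isCompact_closedBall _ _)
  have h1 := (setIntegral_eq_zero_iff_of_nonneg_ae (Eventually.of_forall hk0) hi).1 h
  have h2 : k =ᵐ[volume.restrict (Metric.ball (0 : E3) L)] fun _ => 0 :=
    ae_restrict_of_ae_restrict_of_subset Metric.ball_subset_closedBall h1
  have h3 := Measure.eqOn_open_of_ae_eq h2 Metric.isOpen_ball hk.continuousOn continuousOn_const
  have h4 := h3.closure hk continuous_const
  rw [closure_ball _ hL.ne'] at h4
  exact h4 hx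

/-- Uniqueness of the normalized positive ground state. -/
lemma IsNeumannGroundState.unique {μ L : ℝ} {v f g : E3 → ℝ} (hμ : 0 < μ) (hL : 0 < L)
    (hv : Measurable v) (hv0 : ∀ x, 0 ≤ v x) (hvB : ∃ M, ∀ x, v x ≤ M)
    (hf : IsNeumannGroundState μ v L f) (hg : IsNeumannGroundState μ v L g) (x : E3) :
    f x = g x := by
  obtain ⟨B, hB⟩ := hvB
  have hB' : ∀ x, |v x| ≤ B := fun x => by rw [abs_of_nonneg (hv0 x)]; exact hB x
  have hfpos : ∀ x, 0 < f x := fun x => by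
    rcases le_total ‖x‖ L with h | h
    · exact hf.pos x h
    · rw [hf.eq_one x h]; exact one_pos
  -- Ground state substitution `g = f h`. The equation of `f` is tested with `f h² = g² / f` and
  -- that of `g` with `g`; the potential and energy terms agree, and the difference of the gradient
  -- terms is `μ f² |∇h|²`. So `h` is constant on the ball, equal to its boundary value `1`.
  set h : E3 → ℝ := fun x => g x / f x with hh
  have hh1 : ContDiff ℝ 1 h := hg.contDiff.div hf.contDiff fun x => (hfpos x).ne'
  have hgfh : g = fun x => f x * h x := funext fun x => by
    simp only [hh]; have := (hfpos x).ne'; field_simp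
  set φ : E3 → ℝ := fun x => f x * h x ^ 2 with hφ
  have hφ1 : ContDiff ℝ 1 φ := hf.contDiff.mul (hh1.pow 2)
  have df := hf.contDiff.differentiable one_ne_zero
  have dh := hh1.differentiable one_ne_zero
  have gg : ∀ x, ∇ g x = f x • ∇ h x + h x • ∇ f x := fun x => by
    simp only [gradient]
    rw [hgfh, fderiv_fun_mul (df x) (dh x)]
    simp
  have gφ : ∀ x, ∇ φ x = (2 * f x * h x) • ∇ h x + h x ^ 2 • ∇ f x := fun x => by
    simp only [gradient, hφ]
    rw [fderiv_fun_mul (df x) ((dh x).fun_pow 2), fderiv_fun_pow 2 (dh x)]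
    simp [smul_smul]
    ring_nf
  have cf := hf.contDiff.continuous
  have cg := hg.contDiff.continuous
  have ch := hh1.continuous
  have cφ := hφ1.continuous
  have cf' := continuous_gradient hf.contDiff
  have ch' := continuous_gradient hh1
  have cg' := continuous_gradient hg.contDiff
  have cφ' := continuous_gradient hφ1
  have hint : ∀ a b : E3 → ℝ, Continuous a → Continuous b →
      IntegrableOn (fun x => a x + v x * b x) (Metric.closedBall 0 L) := fun a b ha hb => by
    refine (ha.continuousOn.integrableOn_compact (isCompact_closedBall _ _)).add ?_
    exact (hb.continuousOn.integrableOn_compact (isCompact_closedBall _ _)).bdd_mul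
      hv.aestronglyMeasurable (Eventually.of_forall hB')
  have e1 := hf.equation φ hφ1
  have e2 := hg.equation g hg.contDiff
  have e3 : ∫ x in Metric.closedBall 0 L, f x * φ x = ∫ x in Metric.closedBall 0 L, g x * g x := by
    refine integral_congr_ae (Eventually.of_forall fun x => ?_)
    simp only [hφ, hgfh]; ring
  rw [e3, ← e2] at e1
  have i1 := hint (fun x => μ * inner ℝ (∇ f x) (∇ φ x)) (fun x => f x * φ x) (by fun_prop)
    (by fun_prop)
  have i2 := hint (fun x => μ * inner ℝ (∇ g x) (∇ g x)) (fun x => g x * g x) (by fun_prop)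
    (by fun_prop)
  simp_rw [← mul_assoc] at i1 i2
  have e4 := integral_sub i2 i1
  rw [e1, sub_self] at e4
  have e5 : ∫ x in Metric.closedBall 0 L, μ * (f x ^ 2 * ‖∇ h x‖ ^ 2) = 0 := by
    rw [← e4]
    refine integral_congr_ae (Eventually.of_forall fun x => ?_)
    have : g x = f x * h x := congrFun hgfh x
    have hφx : φ x = f x * h x ^ 2 := rfl
    simp only [gg, gφ, inner_add_left, inner_add_right, inner_smul_left, inner_smul_right,
      real_inner_self_eq_norm_sq, hφx, this, real_inner_comm (∇ h x) (∇ f x)]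
    simp
    ring
  have e6 : ∀ y ∈ Metric.closedBall (0 : E3) L, fderiv ℝ h y = 0 := fun y hy => by
    have := eq_zero_of_setIntegral_closedBall_eq_zero hL
      (k := fun x => μ * (f x ^ 2 * ‖∇ h x‖ ^ 2)) (by fun_prop) (fun x => by positivity) e5 hy
    have h2 : ∇ h y = 0 := by simpa [hμ.ne', (hfpos y).ne'] using this
    rw [← toDual_gradient (𝕜 := ℝ), h2, map_zero]
  rcases le_total L ‖x‖ with hx | hx
  · rw [hf.eq_one x hx, hg.eq_one x hx]
  · obtain ⟨y, hy⟩ : ∃ y : E3, ‖y‖ = L :=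
      ⟨EuclideanSpace.single 0 L, by simp [abs_of_pos hL]⟩
    have h1 := (convex_closedBall (0 : E3) L).norm_image_sub_le_of_norm_fderiv_le (f := h)
      (𝕜 := ℝ) (C := 0) (fun y _ => dh y) (fun y hy => by rw [e6 y hy, norm_zero])
      (x := y) (y := x) (by simp [hy]) (by simpa using hx)
    have h2 : h x = h y := by
      rw [zero_mul] at h1
      exact sub_eq_zero.1 (norm_le_zero_iff.1 h1)
    have h3 : h y = 1 := by simp [hh, hf.eq_one y hy.ge, hg.eq_one y hy.ge]
    have h4 := congrFun hgfh x
    simp only [h2, h3, mul_one] at h4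
    exact h4.symm

lemma IsNeumannGroundState.radial {μ L : ℝ} {v f : E3 → ℝ} (hμ : 0 < μ) (hL : 0 < L)
    (hv : Measurable v) (hv0 : ∀ x, 0 ≤ v x) (hvB : ∃ M, ∀ x, v x ≤ M)
    (hrad : ∀ x y, ‖x‖ = ‖y‖ → v x = v y) (hf : IsNeumannGroundState μ v L f) {x y : E3}
    (h : ‖x‖ = ‖y‖) : f x = f y := by
  obtain ⟨T, rfl⟩ := exists_isometry_of_norm_eq h
  exact hf.unique hμ hL hv hv0 hvB (hf.comp_isometry hrad T) x

/-! ### From the weak equation to the integrated radial equation -/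

/-- A du Bois-Reymond argument: integrating `q η` by parts turns the hypothesis into orthogonality
of `p - ∫ q` to every admissible `2 r χ(r²)`. Test functions depend on `r²` so that they are `C¹` at
the origin of space. -/
lemma eq_integral_of_weak_radial {p q : ℝ → ℝ} {L : ℝ} (hL : 0 < L) (hp : Continuous p)
    (hq : ∀ a b, IntervalIntegrable q volume a b)
    (h : ∀ η χ : ℝ → ℝ, (∀ t, HasDerivAt η (χ t) t) → Continuous χ → (∀ t, L ^ 2 ≤ t → η t = 0) →
      (∀ t, L ^ 2 ≤ t → χ t = 0) →
      ∫ r in (0 : ℝ)..L, (p r * (2 * r * χ (r ^ 2)) + q r * η (r ^ 2)) = 0)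
    {r : ℝ} (hr : r ∈ Set.Icc 0 L) : p r = ∫ s in (0 : ℝ)..r, q s := by
  set H : ℝ → ℝ := fun r => ∫ s in (0 : ℝ)..r, q s with hH
  have hHc : Continuous H := intervalIntegral.continuous_primitive hq 0
  set G : ℝ → ℝ := fun r => p r - H r with hG
  have hGc : Continuous G := hp.sub hHc
  -- The choice of `χ` that produces a square: at `t = r²` it is `G r` times a weight that is
  -- positive for `r < L` and vanishes from `L` on.
  set χ : ℝ → ℝ := fun t => G (√t) * max (L ^ 2 - t) 0 with hχ
  have hχc : Continuous χ := (hGc.comp Real.continuous_sqrt).mul (by fun_prop)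
  set η : ℝ → ℝ := fun t => ∫ s in (L ^ 2)..t, χ s with hη
  have hηd : ∀ t, HasDerivAt η (χ t) t := fun t =>
    intervalIntegral.integral_hasDerivAt_right (hχc.intervalIntegrable _ _)
      (hχc.stronglyMeasurableAtFilter _ _) hχc.continuousAt
  have hχ0 : ∀ t, L ^ 2 ≤ t → χ t = 0 := fun t ht => by
    simp only [hχ]; rw [max_eq_right (by linarith), mul_zero]
  have hη0 : ∀ t, L ^ 2 ≤ t → η t = 0 := fun t ht => by
    simp only [hη]
    rw [intervalIntegral.integral_of_le ht]
    exact setIntegral_eq_zero_of_forall_eq_zero fun s hs => hχ0 s hs.1.le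
  have hηc : Continuous η := continuous_iff_continuousAt.2 fun t => (hηd t).continuousAt
  have h1 := h η χ hηd hχc hη0 hχ0
  have hkc : Continuous fun r : ℝ => 2 * r * χ (r ^ 2) := by fun_prop
  have hcomp : ∀ r, HasDerivAt (fun r => η (r ^ 2)) (2 * r * χ (r ^ 2)) r := fun r => by
    have := (hηd (r ^ 2)).comp r (hasDerivAt_pow 2 r)
    refine this.congr_deriv ?_
    simp; ring
  have h2 := integral_by_parts_of_primitive (p := H) (q := q) (η := fun r => η (r ^ 2))
    (k := fun r => 2 * r * χ (r ^ 2)) hL.le (hq 0 L) (hkc.intervalIntegrable _ _)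
    (fun x _ => by simp [hH])
    (fun x _ => by
      rw [intervalIntegral.integral_eq_sub_of_hasDerivAt (fun s _ => hcomp s)
        (hkc.intervalIntegrable _ _)]; ring)
  have hH0 : H 0 = 0 := by simp [hH]
  rw [hη0 (L ^ 2) le_rfl, hH0, mul_zero, zero_mul, sub_zero] at h2
  have hqη : IntervalIntegrable (fun r => q r * η (r ^ 2)) volume 0 L :=
    (hq 0 L).mul_continuousOn (hηc.comp (continuous_pow 2)).continuousOn
  have h3 := intervalIntegral.integral_sub
    (((hp.mul hkc).intervalIntegrable 0 L).add hqη) (((hHc.mul hkc).intervalIntegrable 0 L).add hqη)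
  have h4 : ∫ r in (0 : ℝ)..L, G r ^ 2 * (2 * r * (L ^ 2 - r ^ 2)) = 0 := by
    have h5 : ∫ r in (0 : ℝ)..L, G r ^ 2 * (2 * r * (L ^ 2 - r ^ 2)) =
        ∫ r in (0 : ℝ)..L, ((p r * (2 * r * χ (r ^ 2)) + q r * η (r ^ 2)) -
          (H r * (2 * r * χ (r ^ 2)) + q r * η (r ^ 2))) := by
      refine intervalIntegral.integral_congr fun s hs => ?_
      rw [Set.uIcc_of_le hL.le] at hs
      have e1 : χ (s ^ 2) = G s * (L ^ 2 - s ^ 2) := by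
        simp only [hχ]
        rw [Real.sqrt_sq hs.1, max_eq_left (by nlinarith [hs.1, hs.2])]
      simp only [e1]
      simp only [hG]
      ring
    rw [h5]
    refine h3.trans ?_
    simp only [Pi.mul_apply]
    rw [h1, h2, sub_zero]
  have hcG : Continuous fun r => G r ^ 2 * (2 * r * (L ^ 2 - r ^ 2)) := by fun_prop
  have h0 : ∀ c ∈ Set.Ioo 0 L, G c = 0 := by
    intro c hc
    by_contra hne
    have := intervalIntegral.integral_pos hL hcG.continuousOn
      (fun s hs => by
        have : 0 ≤ L ^ 2 - s ^ 2 := by nlinarith [hs.1, hs.2]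
        have := hs.1
        positivity)
      ⟨c, ⟨hc.1.le, hc.2.le⟩, by
        have : 0 < L ^ 2 - c ^ 2 := by nlinarith [hc.1, hc.2]
        have := hc.1
        positivity⟩
    exact this.ne' h4
  have h6 : Set.EqOn G (fun _ => 0) (closure (Set.Ioo 0 L)) :=
    Set.EqOn.closure h0 hGc continuous_const
  rw [closure_Ioo hL.ne] at h6
  exact sub_eq_zero.1 (h6 hr)

/-- A fixed unit vector. -/
noncomputable def axis : E3 := EuclideanSpace.single 0 1

lemma norm_axis : ‖axis‖ = 1 := by simp [axis]

lemma norm_smul_axis {r : ℝ} (hr : 0 ≤ r) : ‖r • axis‖ = r := by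
  rw [norm_smul, norm_axis, mul_one, Real.norm_of_nonneg hr]

/-- The restriction of a function on space to the line through the fixed unit vector. -/
noncomputable def profile (f : E3 → ℝ) (r : ℝ) : ℝ := f (r • axis)

/-- The derivative of the restriction to the line through the fixed unit vector. -/
noncomputable def profileDeriv (f : E3 → ℝ) (r : ℝ) : ℝ := fderiv ℝ f (r • axis) axis

lemma hasDerivAt_profile {f : E3 → ℝ} (hf : ContDiff ℝ 1 f) (r : ℝ) :
    HasDerivAt (profile f) (profileDeriv f r) r := by
  have h1 : HasDerivAt (fun r : ℝ => r • axis) axis r := by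
    simpa using (hasDerivAt_id r).smul_const axis
  exact ((hf.differentiable one_ne_zero) (r • axis)).hasFDerivAt.comp_hasDerivAt r h1

lemma continuous_profileDeriv {f : E3 → ℝ} (hf : ContDiff ℝ 1 f) :
    Continuous (profileDeriv f) := by
  have := hf.continuous_fderiv one_ne_zero
  unfold profileDeriv
  fun_prop

lemma continuous_profile {f : E3 → ℝ} (hf : Continuous f) : Continuous (profile f) := by
  unfold profile
  fun_prop

lemma eq_profile_norm {f : E3 → ℝ} (h : ∀ x y, ‖x‖ = ‖y‖ → f x = f y) (x : E3) :
    f x = profile f ‖x‖ := h _ _ (norm_smul_axis (norm_nonneg x)).symm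

lemma fderiv_apply_self_of_radial {f : E3 → ℝ} (hf : ContDiff ℝ 1 f)
    (h : ∀ x y, ‖x‖ = ‖y‖ → f x = f y) (x : E3) :
    fderiv ℝ f x x = ‖x‖ * profileDeriv f ‖x‖ := by
  have h1 : HasDerivAt (fun s : ℝ => f (s • x)) (fderiv ℝ f x x) 1 := by
    have h2 : HasDerivAt (fun s : ℝ => s • x) x 1 := by
      simpa using (hasDerivAt_id (1 : ℝ)).smul_const x
    have h3 : HasFDerivAt f (fderiv ℝ f x) ((1 : ℝ) • x) := by
      rw [one_smul]; exact ((hf.differentiable one_ne_zero) x).hasFDerivAt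
    exact h3.comp_hasDerivAt 1 h2
  have h4 : HasDerivAt (fun s : ℝ => profile f (s * ‖x‖)) (profileDeriv f ‖x‖ * ‖x‖) 1 := by
    have h5 : HasDerivAt (fun s : ℝ => s * ‖x‖) ‖x‖ 1 := by
      simpa using (hasDerivAt_id (1 : ℝ)).mul_const ‖x‖
    have h6 : HasDerivAt (profile f) (profileDeriv f ‖x‖) (1 * ‖x‖) := by
      rw [one_mul]; exact hasDerivAt_profile hf ‖x‖
    exact h6.comp 1 h5
  have h7 : (fun s : ℝ => f (s • x)) = fun s : ℝ => profile f (s * ‖x‖) := funext fun s => by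
    refine h _ _ ?_
    rw [norm_smul, norm_smul, norm_axis, mul_one, norm_mul, norm_norm]
  rw [h7] at h1
  rw [h1.unique h4, mul_comm]

lemma norm_gradient_of_radial {f : E3 → ℝ} (hf : ContDiff ℝ 1 f)
    (h : ∀ x y, ‖x‖ = ‖y‖ → f x = f y) {x : E3} (hx : x ≠ 0) :
    ‖∇ f x‖ = |profileDeriv f ‖x‖| := by
  have hd : DifferentiableAt ℝ (fun x : E3 => ‖x‖) x := (contDiffAt_norm ℝ hx).differentiableAt
    one_ne_zero
  have h1 : HasFDerivAt f (profileDeriv f ‖x‖ • fderiv ℝ (fun x : E3 => ‖x‖) x) x := by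
    have := (hasDerivAt_profile hf ‖x‖).comp_hasFDerivAt x hd.hasFDerivAt
    exact this.congr_of_eventuallyEq (Eventually.of_forall fun y => eq_profile_norm h y)
  rw [norm_gradient_eq, h1.fderiv, norm_smul, norm_fderiv_norm hd, mul_one, Real.norm_eq_abs]

/-- A radial function is even, so its gradient at the origin is its own negative. -/
lemma gradient_zero_of_radial {f : E3 → ℝ} (hf : ContDiff ℝ 1 f)
    (h : ∀ x y, ‖x‖ = ‖y‖ → f x = f y) : ∇ f 0 = 0 := by
  have h1 : (fun x => f (LinearIsometryEquiv.neg ℝ x)) = f := funext fun x => h _ _ (by simp)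
  have h2 := gradient_comp_isometry (hf.differentiable one_ne_zero) (LinearIsometryEquiv.neg ℝ) 0
  rw [h1] at h2
  simp only [map_zero] at h2
  have h3 : ∇ f 0 = -∇ f 0 := h2
  have h4 : (2 : ℝ) • ∇ f 0 = 0 := by rw [two_smul]; exact add_eq_zero_iff_eq_neg.2 h3
  simpa using h4

lemma integral_radial (h : ℝ → ℝ) :
    ∫ x : E3, h ‖x‖ = 4 * Real.pi * ∫ r in Set.Ioi (0 : ℝ), r ^ 2 * h r := by
  rw [integral_fun_norm_addHaar]
  simp only [finrank_euclideanSpace, Fintype.card_fin, Measure.real,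
    EuclideanSpace.volume_ball_fin_three, smul_eq_mul, nsmul_eq_mul]
  rw [ENNReal.toReal_mul, ENNReal.toReal_ofReal (by positivity)]
  norm_num
  ring

lemma setIntegral_closedBall_radial {L : ℝ} (hL : 0 ≤ L) (h : ℝ → ℝ) :
    ∫ x in Metric.closedBall (0 : E3) L, h ‖x‖ =
      4 * Real.pi * ∫ r in (0 : ℝ)..L, r ^ 2 * h r := by
  rw [← integral_indicator Metric.isClosed_closedBall.measurableSet]
  have h1 : (Metric.closedBall (0 : E3) L).indicator (fun x => h ‖x‖) =
      fun x => (Set.Iic L).indicator h ‖x‖ := by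
    ext x; simp [Set.indicator]
  rw [h1, integral_radial, intervalIntegral.integral_of_le hL]
  congr 1
  rw [← Set.Ioi_inter_Iic, ← setIntegral_indicator measurableSet_Iic]
  refine integral_congr_ae (Eventually.of_forall fun r => ?_)
  by_cases hr : r ≤ L <;> simp [Set.indicator, hr]

lemma integral_radial_of_eq_zero {L : ℝ} (hL : 0 ≤ L) (h : ℝ → ℝ) (h0 : ∀ r, L < r → h r = 0) :
    ∫ x : E3, h ‖x‖ = 4 * Real.pi * ∫ r in (0 : ℝ)..L, r ^ 2 * h r := by
  rw [← setIntegral_closedBall_radial hL, setIntegral_eq_integral_of_forall_compl_eq_zero]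
  intro x hx
  exact h0 _ (by simpa using hx)

lemma hasFDerivAt_comp_norm_sq {η χ : ℝ → ℝ} (hη : ∀ t, HasDerivAt η (χ t) t) (x : E3) :
    HasFDerivAt (fun x : E3 => η (‖x‖ ^ 2)) (χ (‖x‖ ^ 2) • (2 • innerSL ℝ x)) x :=
  (hη (‖x‖ ^ 2)).comp_hasFDerivAt x (hasStrictFDerivAt_norm_sq x).hasFDerivAt

lemma contDiff_comp_norm_sq {η χ : ℝ → ℝ} (hη : ∀ t, HasDerivAt η (χ t) t) (hχ : Continuous χ) :
    ContDiff ℝ 1 (fun x : E3 => η (‖x‖ ^ 2)) := by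
  have h1 : ContDiff ℝ 1 η := by
    rw [contDiff_one_iff_deriv]
    exact ⟨fun t => (hη t).differentiableAt, by rwa [funext fun t => (hη t).deriv]⟩
  exact h1.comp (contDiff_norm_sq ℝ)

/-- The gradient of `η(|x|²)` is `2 χ(|x|²) x`, so only the derivative of `f` along `x` enters and
the origin needs no separate treatment. -/
lemma inner_gradient_radial_test {f : E3 → ℝ} (hf : ContDiff ℝ 1 f)
    (h : ∀ x y, ‖x‖ = ‖y‖ → f x = f y) {η χ : ℝ → ℝ} (hη : ∀ t, HasDerivAt η (χ t) t) (x : E3) :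
    inner ℝ (∇ f x) (∇ (fun x : E3 => η (‖x‖ ^ 2)) x) =
      2 * χ (‖x‖ ^ 2) * (‖x‖ * profileDeriv f ‖x‖) := by
  rw [real_inner_comm, inner_gradient_left, (hasFDerivAt_comp_norm_sq hη x).fderiv,
    ← fderiv_apply_self_of_radial hf h, ← inner_gradient_left, real_inner_comm]
  simp
  ring

/-- The only property of the infimum that is used; otherwise the energy enters only as the
eigenvalue in the equation. -/
lemma neumannEnergy_nonneg {μ L : ℝ} {v : E3 → ℝ} (hμ : 0 < μ) (hv0 : ∀ x, 0 ≤ v x) :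
    0 ≤ neumannEnergy μ v L := by
  refine Real.sInf_nonneg ?_
  rintro q ⟨φ, -, hpos, rfl⟩
  refine div_nonneg (integral_nonneg fun x => ?_) hpos.le
  have := hv0 x
  simp only [Pi.zero_apply]
  positivity

lemma measurable_profile {v : E3 → ℝ} (hv : Measurable v) : Measurable (profile v) :=
  hv.comp (by fun_prop : Continuous fun r : ℝ => r • axis).measurable

lemma profile_nonneg {v : E3 → ℝ} (hv0 : ∀ x, 0 ≤ v x) (r : ℝ) : 0 ≤ profile v r := hv0 _

lemma IsScatteringSolution.isRadialScattering {μ R : ℝ} {v f : E3 → ℝ} (hμ : 0 < μ)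
    (hv : Measurable v) (hv0 : ∀ x, 0 ≤ v x) (hvB : ∃ M, ∀ x, v x ≤ M)
    (hrad : ∀ x y, ‖x‖ = ‖y‖ → v x = v y) (hR : 0 < R) (hsupp : ∀ x, R < ‖x‖ → v x = 0)
    (hf : IsScatteringSolution μ v f) :
    IsRadialScattering (fun r => profile v r / μ) (profile f) (profileDeriv f) R where
  measurable := (measurable_profile hv).div_const μ
  nonneg r := div_nonneg (hv0 _) hμ.le
  bdd := by
    obtain ⟨M, hM⟩ := hvB
    exact ⟨M / μ, fun r => by gcongr; exact hM _⟩
  radius_pos := hR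
  eq_zero r hr := by
    rw [profile, hsupp _ (by rwa [norm_smul_axis (hR.trans hr).le]), zero_div]
  hasDerivAt := hasDerivAt_profile hf.contDiff
  continuous_deriv := continuous_profileDeriv hf.contDiff
  sol_nonneg r _ := hf.nonneg hμ hv hv0 hvB _
  tendsto_one := by
    refine hf.tendsto_one.comp ?_
    rw [← Metric.cobounded_eq_cocompact, ← tendsto_norm_atTop_iff_cobounded]
    simp_rw [norm_smul, norm_axis, mul_one]
    exact tendsto_norm_atTop_atTop
  flux r hr := by
    have hfr : ∀ x y, ‖x‖ = ‖y‖ → f x = f y := fun x y => hf.radial hμ hv hv0 hvB hrad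
    obtain ⟨M, hM⟩ := hvB
    have hFc := continuous_profile hf.contDiff.continuous
    have hF'c := continuous_profileDeriv hf.contDiff
    -- Any positive radius at least `r` would do; the test functions are supported in this ball.
    set L := r + 1
    have hL : 0 < L := by positivity
    refine eq_integral_of_weak_radial hL (p := fun r => r ^ 2 * profileDeriv f r)
      (q := fun s => profile v s / μ * (profile f s * s ^ 2)) (by fun_prop) (fun a b => ?_)
      (fun η χ hη hχ hη0 hχ0 => ?_) ⟨hr, by simp [L]⟩
    · refine intervalIntegrable_bdd_mul_continuous (B := M / μ)
        ((measurable_profile hv).div_const μ) (fun s => ?_) (by fun_prop) a b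
      rw [abs_of_nonneg (div_nonneg (profile_nonneg hv0 s) hμ.le)]
      gcongr
      exact hM _
    · have hc : HasCompactSupport (fun x : E3 => η (‖x‖ ^ 2)) :=
        HasCompactSupport.intro (isCompact_closedBall 0 L) fun x hx => by
          have : L < ‖x‖ := by simpa using hx
          exact hη0 _ (by gcongr)
      have h1 := hf.equation _ (contDiff_comp_norm_sq hη hχ) hc
      simp_rw [inner_gradient_radial_test hf.contDiff hfr hη, eq_profile_norm hrad,
        eq_profile_norm hfr] at h1
      rw [integral_radial_of_eq_zero hL.le (fun r => μ * (2 * χ (r ^ 2) * (r * profileDeriv f r)) +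
        profile v r * profile f r * η (r ^ 2))] at h1
      · have h2 := (mul_eq_zero.1 h1).resolve_left (by positivity)
        refine (mul_right_inj' hμ.ne').1 (Eq.trans ?_ (h2.trans (mul_zero μ).symm))
        rw [← intervalIntegral.integral_const_mul]
        refine intervalIntegral.integral_congr fun s _ => ?_
        field_simp
      · intro s hs
        have : L ^ 2 ≤ s ^ 2 := by gcongr
        simp only [hη0 _ this, hχ0 _ this]
        ring

lemma IsNeumannGroundState.isRadialNeumann {μ L : ℝ} {v f : E3 → ℝ} (hμ : 0 < μ) (hL : 0 < L)
    (hv : Measurable v) (hv0 : ∀ x, 0 ≤ v x) (hvB : ∃ M, ∀ x, v x ≤ M)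
    (hrad : ∀ x y, ‖x‖ = ‖y‖ → v x = v y) (hf : IsNeumannGroundState μ v L f) :
    IsRadialNeumann (fun r => profile v r / μ) (profile f) (profileDeriv f)
      (neumannEnergy μ v L / μ) L where
  energy_nonneg := div_nonneg (neumannEnergy_nonneg hμ hv0) hμ.le
  hasDerivAt := hasDerivAt_profile hf.contDiff
  continuous_deriv := continuous_profileDeriv hf.contDiff
  pos r hr hrL := hf.pos _ (by rwa [norm_smul_axis hr])
  eq_one := hf.eq_one _ (norm_smul_axis hL.le).ge
  deriv_eq_zero := by
    have h1 := hf.radial_deriv (L • axis) (norm_smul_axis hL.le)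
    rw [map_smul, smul_eq_mul] at h1
    exact (mul_eq_zero.1 h1).resolve_left hL.ne'
  flux r hr hrL := by
    have hfr : ∀ x y, ‖x‖ = ‖y‖ → f x = f y := fun x y => hf.radial hμ hL hv hv0 hvB hrad
    obtain ⟨M, hM⟩ := hvB
    have hFc := continuous_profile hf.contDiff.continuous
    have hF'c := continuous_profileDeriv hf.contDiff
    have hq : ∀ h : ℝ → ℝ, Continuous h → ∀ a b,
        IntervalIntegrable (fun s => profile v s * h s) volume a b := fun h hh a b =>
      intervalIntegrable_bdd_mul_continuous (B := M) (measurable_profile hv)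
        (fun s => by rw [abs_of_nonneg (profile_nonneg hv0 s)]; exact hM _) hh a b
    refine eq_integral_of_weak_radial hL (p := fun r => r ^ 2 * profileDeriv f r)
      (q := fun s => (profile v s / μ - neumannEnergy μ v L / μ) * (profile f s * s ^ 2))
      (by fun_prop) (fun a b => ?_) (fun η χ hη hχ hη0 hχ0 => ?_) ⟨hr, hrL⟩
    · have := (hq (fun s => profile f s * s ^ 2 / μ) (by fun_prop) a b).sub
        (Continuous.intervalIntegrable (by fun_prop :
          Continuous fun s => neumannEnergy μ v L / μ * (profile f s * s ^ 2)) a b)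
      refine this.congr fun s _ => ?_
      ring
    · have hηc : Continuous η := continuous_iff_continuousAt.2 fun t => (hη t).continuousAt
      have h1 := hf.equation _ (contDiff_comp_norm_sq hη hχ)
      simp_rw [inner_gradient_radial_test hf.contDiff hfr hη, eq_profile_norm hrad,
        eq_profile_norm hfr] at h1
      rw [setIntegral_closedBall_radial hL.le
        (fun r => μ * (2 * χ (r ^ 2) * (r * profileDeriv f r)) +
        profile v r * profile f r * η (r ^ 2)),
        setIntegral_closedBall_radial hL.le (fun r => profile f r * η (r ^ 2))] at h1
      have h2 : ∫ s in (0 : ℝ)..L, s ^ 2 * (μ * (2 * χ (s ^ 2) * (s * profileDeriv f s)) +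
          profile v s * profile f s * η (s ^ 2)) =
          neumannEnergy μ v L * ∫ s in (0 : ℝ)..L, s ^ 2 * (profile f s * η (s ^ 2)) := by
        have : (4 * Real.pi) ≠ 0 := by positivity
        refine mul_left_cancel₀ this ?_
        rw [h1]; ring
      have i1 : IntervalIntegrable (fun s => s ^ 2 * (μ * (2 * χ (s ^ 2) *
          (s * profileDeriv f s)) + profile v s * profile f s * η (s ^ 2))) volume 0 L := by
        have := (Continuous.intervalIntegrable (by fun_prop : Continuous fun s =>
          s ^ 2 * (μ * (2 * χ (s ^ 2) * (s * profileDeriv f s)))) 0 L).add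
          (hq (fun s => s ^ 2 * profile f s * η (s ^ 2)) (by fun_prop) 0 L)
        refine this.congr fun s _ => ?_
        ring
      rw [← intervalIntegral.integral_const_mul, ← sub_eq_zero,
        ← intervalIntegral.integral_sub i1 (Continuous.intervalIntegrable (by fun_prop) _ _)] at h2
      refine (mul_right_inj' hμ.ne').1 (Eq.trans ?_ (h2.trans (mul_zero μ).symm))
      rw [← intervalIntegral.integral_const_mul]
      refine intervalIntegral.integral_congr fun s _ => ?_
      field_simp
      ring

/-- The flux at the edge of the support is the radial form of the integral of `v f₀ / (4 π μ)`. -/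
lemma scatteringLength_eq {μ R : ℝ} {v f : E3 → ℝ} (hμ : 0 < μ)
    (hrad : ∀ x y, ‖x‖ = ‖y‖ → v x = v y) (hfr : ∀ x y, ‖x‖ = ‖y‖ → f x = f y)
    (S : IsRadialScattering (fun r => profile v r / μ) (profile f) (profileDeriv f) R) :
    scatteringLength μ v f = R ^ 2 * profileDeriv f R := by
  rw [S.flux R S.radius_pos.le, scatteringLength]
  simp_rw [eq_profile_norm hrad, eq_profile_norm hfr]
  rw [integral_radial_of_eq_zero S.radius_pos.le (fun r => profile v r * profile f r),
    ← intervalIntegral.integral_const_mul, ← intervalIntegral.integral_const_mul]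
  · refine intervalIntegral.integral_congr fun s _ => ?_
    field_simp
  · intro r hr
    have := S.eq_zero r hr
    rw [(div_eq_zero_iff.1 this).resolve_right hμ.ne', zero_mul]

/-! ### Essential supremum and capacity -/

/-- The essential supremum bounds the profile almost everywhere. -/
lemma ae_profile_le {v : E3 → ℝ} (hv0 : ∀ x, 0 ≤ v x)
    (hvB : ∃ M, ∀ x, v x ≤ M) (hrad : ∀ x y, ‖x‖ = ‖y‖ → v x = v y) :
    ∀ᵐ r : ℝ, 0 < r → profile v r ≤ (eLpNorm v ⊤ volume).toReal := by
  obtain ⟨B, hB⟩ := hvB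
  have hfin : eLpNorm v ⊤ volume ≠ ⊤ := by
    rw [eLpNorm_exponent_top]
    refine (eLpNormEssSup_lt_top_of_ae_bound (C := B) (Eventually.of_forall fun x => ?_)).ne
    rw [Real.norm_of_nonneg (hv0 x)]; exact hB x
  set M := (eLpNorm v ⊤ volume).toReal with hM
  have h1 : ∀ᵐ x : E3, v x ≤ M := by
    filter_upwards [ae_le_eLpNormEssSup (f := v) (μ := volume)] with x hx
    rw [← eLpNorm_exponent_top] at hx
    have h2 := ENNReal.toReal_mono hfin hx
    simp only [toReal_enorm] at h2
    rwa [Real.norm_of_nonneg (hv0 x)] at h2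
  -- Indicator of the radii where the bound fails. Its integral over space is zero, so in polar
  -- coordinates `r² k r = 0` for almost every `r > 0`; the weight can be divided out only there.
  set k : ℝ → ℝ := fun r => if profile v r ≤ M then 0 else 1 with hk
  have h2 : (fun x : E3 => k ‖x‖) =ᵐ[volume] 0 := by
    filter_upwards [h1] with x hx
    rw [eq_profile_norm hrad x] at hx
    simp [hk, hx]
  have h3 : Integrable (fun x : E3 => k ‖x‖) := (integrable_zero _ _ _).congr h2.symm
  have h4 : ∫ x : E3, k ‖x‖ = 0 := integral_eq_zero_of_ae h2
  rw [integrable_fun_norm_addHaar] at h3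
  simp only [finrank_euclideanSpace, Fintype.card_fin, smul_eq_mul] at h3
  rw [integral_radial] at h4
  have h5 := (mul_eq_zero.1 h4).resolve_left (by positivity)
  rw [setIntegral_eq_zero_iff_of_nonneg_ae (Eventually.of_forall fun r => ?_) h3] at h5
  · rw [Filter.EventuallyEq, ae_restrict_iff' measurableSet_Ioi] at h5
    filter_upwards [h5] with r hr hr0
    by_contra hne
    have := hr hr0
    simp [hk, hne, hr0.ne'] at this
  · simp only [hk, Pi.zero_apply]
    split_ifs <;> simp
    positivity

lemma lintegral_polar {h : E3 → ENNReal} (hh : Measurable h) :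
    ∫⁻ x, h x = ∫⁻ ω : Metric.sphere (0 : E3) 1,
      ∫⁻ r in Set.Ioi (0 : ℝ), ENNReal.ofReal (r ^ 2) * h (r • (ω : E3))
        ∂(volume : Measure ℝ) ∂((volume : Measure E3).toSphere) := by
  have hdim : Module.finrank ℝ E3 - 1 = 2 := by simp
  have h1 : ∫⁻ x, h x = ∫⁻ x : ({0}ᶜ : Set E3), h x ∂((volume : Measure E3).comap (↑)) := by
    rw [lintegral_subtype_comap (measurableSet_singleton _).compl, restrict_compl_singleton]
  have h2 := (volume : Measure E3).measurePreserving_homeomorphUnitSphereProd.lintegral_comp_emb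
    (Homeomorph.measurableEmbedding _)
    (fun p : Metric.sphere (0 : E3) 1 × Set.Ioi (0 : ℝ) => h (p.2.1 • p.1.1))
  have h3 : ∀ x : ({0}ᶜ : Set E3), h ((homeomorphUnitSphereProd E3 x).2.1 •
      (homeomorphUnitSphereProd E3 x).1.1) = h x := fun x => by
    congr 1
    have hx : ‖(x : E3)‖ ≠ 0 := norm_ne_zero_iff.2 x.2
    simp [smul_smul, hx]
  simp_rw [h3] at h2
  have hm : Measurable fun p : Metric.sphere (0 : E3) 1 × Set.Ioi (0 : ℝ) => h (p.2.1 • p.1.1) :=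
    hh.comp (by fun_prop)
  rw [h1, h2, lintegral_prod _ hm.aemeasurable, hdim]
  refine lintegral_congr fun ω => ?_
  have hm' : Measurable fun r : Set.Ioi (0 : ℝ) => h (r.1 • ω.1) := hh.comp (by fun_prop)
  rw [Measure.volumeIoiPow]
  refine (lintegral_withDensity_eq_lintegral_mul _ (by fun_prop) hm').trans ?_
  simp only [Pi.mul_apply]
  rw [← lintegral_subtype_comap measurableSet_Ioi
    (fun r : ℝ => ENNReal.ofReal (r ^ 2) * h (r • (ω : E3)))]

/-- The one-dimensional capacity estimate along a ray. -/
lemma le_integral_sq_mul_sq {ψ ψ' : ℝ → ℝ} {R T : ℝ} (hR : 0 < R) (hRT : R ≤ T)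
    (hψ : ∀ r, HasDerivAt ψ (ψ' r) r) (hc : Continuous ψ') (h1 : 1 ≤ ψ R) (hT : ψ T = 0) :
    R ≤ ∫ r in R..T, r ^ 2 * ψ' r ^ 2 := by
  -- Expanding `(r ψ' + R / r)² ≥ 0` gives `r² ψ'² ≥ -2 R ψ' - R² / r²`, with equality for the ball
  -- potential `R / r`. The lower bound has this explicit antiderivative.
  have hd : ∀ r ∈ Set.uIcc R T, HasDerivAt (fun r => -(2 * R) * ψ r + R ^ 2 * r⁻¹)
      (-(2 * R) * ψ' r + R ^ 2 * -(r ^ 2)⁻¹) r := fun r hr => by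
    rw [Set.uIcc_of_le hRT] at hr
    exact ((hψ r).const_mul _).add ((hasDerivAt_inv (hR.trans_le hr.1).ne').const_mul _)
  have hcont : ContinuousOn (fun r : ℝ => -(2 * R) * ψ' r + R ^ 2 * -(r ^ 2)⁻¹)
      (Set.uIcc R T) := by
    refine (hc.continuousOn.const_mul _).add (continuousOn_const.mul ?_)
    refine (ContinuousOn.inv₀ (by fun_prop) fun r hr => ?_).neg
    rw [Set.uIcc_of_le hRT] at hr
    exact pow_ne_zero 2 (hR.trans_le hr.1).ne'
  have h2 := intervalIntegral.integral_eq_sub_of_hasDerivAt hd hcont.intervalIntegrable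
  have h3 : ∫ r in R..T, (-(2 * R) * ψ' r + R ^ 2 * -(r ^ 2)⁻¹) ≤
      ∫ r in R..T, r ^ 2 * ψ' r ^ 2 := by
    refine intervalIntegral.integral_mono_on hRT hcont.intervalIntegrable
      (Continuous.intervalIntegrable (by fun_prop) _ _) fun r hr => ?_
    have hr0 : r ≠ 0 := (hR.trans_le hr.1).ne'
    have h4 := sq_nonneg (r * ψ' r + R / r)
    have h5 : (r * ψ' r + R / r) ^ 2 = r ^ 2 * ψ' r ^ 2 + 2 * R * ψ' r + R ^ 2 * (r ^ 2)⁻¹ := by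
      field_simp
      ring
    linarith
  have h6 : R ^ 2 * R⁻¹ = R := by field_simp
  have h7 : 0 ≤ R ^ 2 * T⁻¹ := by
    have := hR.trans_le hRT
    positivity
  rw [h2, hT, h6] at h3
  nlinarith

/-- Apply the ray estimate in every direction, using that the radial derivative is at most the
gradient; the unit sphere has measure `4 π`. -/
lemma le_integral_norm_gradient_sq {φ : E3 → ℝ} {R : ℝ} (hR : 0 < R) (hφ : ContDiff ℝ 1 φ)
    (hc : HasCompactSupport φ) (h1 : ∀ x, ‖x‖ = R → 1 ≤ φ x) :
    R ≤ 1 / (4 * Real.pi) * ∫ x, ‖∇ φ x‖ ^ 2 := by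
  have hg := continuous_gradient hφ
  have hint : Integrable fun x => ‖∇ φ x‖ ^ 2 := by
    refine Continuous.integrable_of_hasCompactSupport (by fun_prop) ?_
    exact (hasCompactSupport_gradient hc).mono' (fun x hx => subset_tsupport _ fun h0 => hx (by
      simp only [h0, norm_zero, ne_eq, OfNat.ofNat_ne_zero, not_false_eq_true, zero_pow]))
  obtain ⟨B, hB⟩ := hc.isCompact.isBounded.subset_closedBall (0 : E3)
  set T := max R (B + 1) with hT
  have hφT : ∀ x : E3, ‖x‖ = T → φ x = 0 := fun x hx => by
    by_contra hne
    have := hB (subset_tsupport _ hne)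
    rw [mem_closedBall_zero_iff, hx] at this
    linarith [le_max_right R (B + 1)]
  have hray : ∀ ω : Metric.sphere (0 : E3) 1, ENNReal.ofReal R ≤
      ∫⁻ r in Set.Ioi (0 : ℝ), ENNReal.ofReal (r ^ 2) *
        ENNReal.ofReal (‖∇ φ (r • (ω : E3))‖ ^ 2) := by
    intro ω
    have hω : ‖(ω : E3)‖ = 1 := by simp
    have hn : ∀ r : ℝ, 0 ≤ r → ‖r • (ω : E3)‖ = r := fun r hr => by
      rw [norm_smul, hω, mul_one, Real.norm_of_nonneg hr]
    have hRT : R ≤ T := le_max_left _ _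
    have hf' := hφ.continuous_fderiv one_ne_zero
    have h2 := le_integral_sq_mul_sq (ψ := fun r => φ (r • (ω : E3)))
      (ψ' := fun r => fderiv ℝ φ (r • (ω : E3)) (ω : E3)) hR hRT (fun r => by
        have h1 : HasDerivAt (fun r : ℝ => r • (ω : E3)) (ω : E3) r := by
          simpa using (hasDerivAt_id r).smul_const (ω : E3)
        exact ((hφ.differentiable one_ne_zero) (r • (ω : E3))).hasFDerivAt.comp_hasDerivAt r h1)
      (by fun_prop) (h1 _ (hn R hR.le)) (hφT _ (hn T (hR.le.trans hRT)))
    have h3 : R ≤ ∫ r in Set.Ioc R T, r ^ 2 * ‖∇ φ (r • (ω : E3))‖ ^ 2 := by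
      rw [← intervalIntegral.integral_of_le hRT]
      refine h2.trans (intervalIntegral.integral_mono_on hRT
        (Continuous.intervalIntegrable (by fun_prop) _ _)
        (Continuous.intervalIntegrable (by fun_prop) _ _) fun r hr => ?_)
      refine mul_le_mul_of_nonneg_left ?_ (sq_nonneg r)
      rw [← sq_abs]
      gcongr
      rw [norm_gradient_eq]
      have := (fderiv ℝ φ (r • (ω : E3))).le_opNorm (ω : E3)
      rwa [hω, mul_one] at this
    calc ENNReal.ofReal R ≤
        ENNReal.ofReal (∫ r in Set.Ioc R T, r ^ 2 * ‖∇ φ (r • (ω : E3))‖ ^ 2) :=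
          ENNReal.ofReal_le_ofReal h3
      _ = ∫⁻ r in Set.Ioc R T, ENNReal.ofReal (r ^ 2 * ‖∇ φ (r • (ω : E3))‖ ^ 2) := by
          refine ofReal_integral_eq_lintegral_ofReal ?_
            (Eventually.of_forall fun r => by positivity)
          exact (Continuous.intervalIntegrable (by fun_prop) R T).1
      _ = ∫⁻ r in Set.Ioc R T, ENNReal.ofReal (r ^ 2) *
            ENNReal.ofReal (‖∇ φ (r • (ω : E3))‖ ^ 2) := by
          simp_rw [fun r : ℝ => ENNReal.ofReal_mul (q := ‖∇ φ (r • (ω : E3))‖ ^ 2) (sq_nonneg r)]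
      _ ≤ _ := lintegral_mono_set fun r hr => hR.trans hr.1
  have h4 : ENNReal.ofReal (R * (4 * Real.pi)) ≤ ENNReal.ofReal (∫ x, ‖∇ φ x‖ ^ 2) := by
    rw [ofReal_integral_eq_lintegral_ofReal hint (Eventually.of_forall fun r => by positivity),
      lintegral_polar (by fun_prop)]
    calc ENNReal.ofReal (R * (4 * Real.pi)) =
        ∫⁻ _ω : Metric.sphere (0 : E3) 1, ENNReal.ofReal R ∂((volume : Measure E3).toSphere) := by
          rw [lintegral_const, Measure.toSphere_apply_univ, EuclideanSpace.volume_ball_fin_three,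
            ENNReal.ofReal_mul hR.le]
          congr 1
          simp only [finrank_euclideanSpace, Fintype.card_fin, ENNReal.ofReal_one, one_pow,
            one_mul]
          rw [← ENNReal.ofReal_natCast, ← ENNReal.ofReal_mul (by positivity)]
          congr 1
          push_cast
          ring
      _ ≤ _ := lintegral_mono hray
  have h5 := (ENNReal.ofReal_le_ofReal_iff (integral_nonneg fun x => by positivity)).1 h4
  rw [one_div, inv_mul_eq_div, le_div_iff₀ (by positivity)]
  exact h5

lemma le_electrostaticCapacity {K : Set E3} {R : ℝ} (hR : 0 < R) (hK : IsCompact K)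
    (hsub : Metric.sphere 0 R ⊆ K) : R ≤ electrostaticCapacity K := by
  refine le_csInf ?_ ?_
  -- An infimum over the empty set would be `0`, so an admissible function has to be exhibited.
  · obtain ⟨B, hB⟩ := hK.isBounded.subset_closedBall (0 : E3)
    let b : ContDiffBump (0 : E3) := ⟨max B 1, max B 1 + 1, by positivity, by linarith⟩
    refine ⟨_, b, b.contDiff, b.hasCompactSupport, fun x hx => ?_, rfl⟩
    refine (b.one_of_mem_closedBall ?_).ge
    exact Metric.closedBall_subset_closedBall (le_max_left _ _) (hB hx)
  · rintro c ⟨φ, hφ, hc, h1, rfl⟩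
    exact le_integral_norm_gradient_sq hR (hφ.of_le (by exact_mod_cast le_top)) hc
      fun x hx => h1 x (hsub (by simpa using hx))

lemma integrable_mul_continuous {v h : E3 → ℝ} {R : ℝ} (hv : Measurable v)
    (hv0 : ∀ x, 0 ≤ v x) (hvB : ∃ M, ∀ x, v x ≤ M) (hsupp : ∀ x, R < ‖x‖ → v x = 0)
    (hh : Continuous h) : Integrable fun x => v x * h x := by
  obtain ⟨B, hB⟩ := hvB
  have h1 : IntegrableOn (fun x => v x * h x) (Metric.closedBall 0 R) :=
    (hh.continuousOn.integrableOn_compact (isCompact_closedBall _ _)).bdd_mul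
      hv.aestronglyMeasurable
      (Eventually.of_forall fun x => by rw [Real.norm_of_nonneg (hv0 x)]; exact hB x)
  refine (integrableOn_iff_integrable_of_support_subset fun x hx => ?_).1 h1
  by_contra hne
  exact hx (by simp only [hsupp x (by simpa using hne), zero_mul])

/-- The support of a nontrivial radial function contains the sphere that bounds it. -/
lemma exists_sphere_subset_tsupport {v : E3 → ℝ} {R₀ : ℝ}
    (hrad : ∀ x y, ‖x‖ = ‖y‖ → v x = v y) (hsupp : ∀ x, R₀ < ‖x‖ → v x = 0)
    (hne : ∃ x, x ≠ 0 ∧ v x ≠ 0) :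
    ∃ R, 0 < R ∧ R ≤ R₀ ∧ (∀ x, R < ‖x‖ → v x = 0) ∧ IsCompact (tsupport v) ∧
      Metric.sphere 0 R ⊆ tsupport v := by
  have hsub : tsupport v ⊆ Metric.closedBall 0 R₀ := by
    refine closure_minimal (fun x hx => ?_) Metric.isClosed_closedBall
    by_contra hn
    exact hx (hsupp x (by simpa using hn))
  have hK : IsCompact (tsupport v) :=
    (isCompact_closedBall _ _).of_isClosed_subset (isClosed_tsupport v) hsub
  obtain ⟨x₀, hx₀, hvx₀⟩ := hne
  have hmem : x₀ ∈ tsupport v := subset_tsupport v hvx₀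
  -- The radius is the largest norm on the support; isometries move the maximizer over the whole
  -- sphere without leaving the support.
  obtain ⟨y, hy, hmax⟩ := hK.exists_isMaxOn ⟨x₀, hmem⟩ continuous_norm.continuousOn
  refine ⟨‖y‖, (norm_pos_iff.2 hx₀).trans_le (hmax hmem), by simpa using hsub hy, fun x hx => ?_,
    hK, fun x hx => ?_⟩
  · by_contra hvx
    exact (hmax (subset_tsupport v hvx)).not_gt hx
  · obtain ⟨T, hT⟩ := exists_isometry_of_norm_eq (mem_sphere_zero_iff_norm.1 hx).symm
    rw [← hT]
    refine map_mem_closure T.continuous hy fun z hz => ?_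
    rw [Function.mem_support, hrad (T z) z (T.norm_map z)]
    exact hz

lemma zetaZero_eq_zero {v : E3 → ℝ} (R₀ : ℝ) (h : v =ᵐ[volume] 0) : zetaZero R₀ v = 0 := by
  rw [zetaZero, eLpNorm_congr_ae h]
  simp

lemma scatteringLength_eq_zero {μ : ℝ} {v f : E3 → ℝ} (h : v =ᵐ[volume] 0) :
    scatteringLength μ v f = 0 := by
  have : ∫ x, v x * f x = 0 := integral_eq_zero_of_ae (by
    filter_upwards [h] with x hx
    simp [hx])
  rw [scatteringLength, this, mul_zero]

lemma gradient_eq_zero_of_lt_norm {μ L : ℝ} {v f : E3 → ℝ} (hf : IsNeumannGroundState μ v L f)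
    {x : E3} (hx : L < ‖x‖) : ∇ f x = 0 := by
  have h1 : f =ᶠ[𝓝 x] fun _ => 1 := by
    filter_upwards [(isOpen_lt continuous_const continuous_norm).mem_nhds hx] with y hy
    exact hf.eq_one y (le_of_lt hy)
  rw [gradient, h1.fderiv_eq]
  simp

/-! ### Assembly of the estimates -/

theorem mainTheorem4 :
    ∃ C : ℝ, 0 < C ∧
      ∀ (R₀ : ℝ) (v : E3 → ℝ), 0 < R₀ → Measurable v → (∀ x, 0 ≤ v x) → (∃ M, ∀ x, v x ≤ M) →
      (∀ x y, ‖x‖ = ‖y‖ → v x = v y) → (∀ x, R₀ < ‖x‖ → v x = 0) →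
      ∀ (μ L : ℝ), 0 < μ → C * R₀ ≤ L →
      ∀ (f₀ f : E3 → ℝ), IsScatteringSolution μ v f₀ → IsNeumannGroundState μ v L f →
      -- (i) the ground state energy
      neumannEnergy μ v L ≤ 3 * μ * scatteringLength μ v f₀ / L ^ 3 * (1 + C * (R₀ / L)) ∧
      -- (ii) pointwise bounds
      (∀ x, Real.exp (-(Real.sqrt (zetaZero R₀ v) / Real.sqrt μ)) ≤ f x ∧ f x ≤ 1) ∧
      (∀ x, x ≠ 0 → 1 - f x ≤
        min (1 - Real.exp (-(Real.sqrt (zetaZero R₀ v) / Real.sqrt μ)))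
          (scatteringLength μ v f₀ / ‖x‖)) ∧
      (∀ x, |f₀ x - f x| ≤ C * (scatteringLength μ v f₀ / L)) ∧
      -- (iii) approximation of the scattering length
      |(∫ x, v x * f x) - 4 * Real.pi * μ * scatteringLength μ v f₀| ≤
        C * (∫ x, v x) * (scatteringLength μ v f₀ / L) ∧
      |(∫ x, v x * f x ^ 2) - ∫ x, v x * f₀ x ^ 2| ≤
        C * R₀ * (μ * scatteringLength μ v f₀ / L) ∧
      -- (iv) pointwise gradient bounds
      (∀ x, x ≠ 0 →
        ‖gradient f x‖ ≤ scatteringLength μ v f₀ * (1 + C * (R₀ / L)) / ‖x‖ ^ 2 ∧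
        ‖gradient f x‖ ≤ (2 + C * (R₀ / L)) / ‖x‖) ∧
      -- (v) gradient bound with a constant independent of μ
      (∀ x, ‖gradient f x‖ ≤ C / (‖x‖ ^ 2 + R₀ ^ 2) *
        (scatteringLength μ v f₀ +
          (electrostaticCapacity (tsupport v) - scatteringLength μ v f₀) / μ *
            zetaZero R₀ v)) := by
  -- The radial lemmas ask for `L ≥ 100 R₀`. The largest constant produced is `16 π < 64`, in the
  -- estimate of `∫ v f²`.
  refine ⟨100, by norm_num, ?_⟩
  intro R₀ v hR₀ hv hv0 hvB hrad hsupp μ L hμ hCL f₀ f h₀ hN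
  have hL : 0 < L := by linarith
  have hf₀r : ∀ x y, ‖x‖ = ‖y‖ → f₀ x = f₀ y := fun x y => h₀.radial hμ hv hv0 hvB hrad
  have hfr : ∀ x y, ‖x‖ = ‖y‖ → f x = f y := fun x y => hN.radial hμ hL hv hv0 hvB hrad
  have S := h₀.isRadialScattering hμ hv hv0 hvB hrad hR₀ hsupp
  have N := hN.isRadialNeumann hμ hL hv hv0 hvB hrad
  have hlen := scatteringLength_eq hμ hrad hf₀r S
  have ha0 : 0 ≤ scatteringLength μ v f₀ := hlen ▸ S.length_nonneg
  have haR : scatteringLength μ v f₀ ≤ R₀ := hlen ▸ S.length_le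
  have hvf₀ : ∫ x, v x * f₀ x = 4 * Real.pi * μ * scatteringLength μ v f₀ := by
    rw [scatteringLength]
    field_simp
  set a := scatteringLength μ v f₀ with ha
  set M := (eLpNorm v ⊤ volume).toReal with hM
  have hM0 : 0 ≤ M := ENNReal.toReal_nonneg
  have haeK : ∀ᵐ s : ℝ, 0 < s → profile v s / μ ≤ M / μ := by
    filter_upwards [ae_profile_le hv0 hvB hrad] with s hs hs0
    gcongr
    exact hs hs0
  have hexp : Real.exp (-(√(zetaZero R₀ v) / √μ)) ≤ profile f₀ 0 := by
    have h1 : √(zetaZero R₀ v) / √μ = √M / √μ * R₀ := by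
      rw [zetaZero, Real.sqrt_mul (sq_nonneg R₀), Real.sqrt_sq hR₀.le]
      ring
    rw [h1]
    refine S.exp_le (by positivity) ?_
    rw [div_pow, Real.sq_sqrt hM0, Real.sq_sqrt hμ.le]
    exact haeK
  have hexp1 : Real.exp (-(√(zetaZero R₀ v) / √μ)) ≤ 1 := hexp.trans (S.le_one le_rfl)
  have haL : 0 ≤ a / L := by positivity
  have hin : ∀ x, ‖x‖ ≤ L → f₀ x ≤ f x := fun x hx => by
    rw [eq_profile_norm hf₀r, eq_profile_norm hfr]
    exact N.scattering_le S (norm_nonneg x) hx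
  have hf1 : ∀ x, f x ≤ 1 := fun x => by
    rcases le_total ‖x‖ L with h | h
    · rw [eq_profile_norm hfr]
      exact N.le_one S hCL (norm_nonneg x) h
    · exact (hN.eq_one x h).le
  have hf₀1 : ∀ x, f₀ x ≤ 1 := fun x => by
    rw [eq_profile_norm hf₀r]; exact S.le_one (norm_nonneg x)
  have hf₀0 : ∀ x, 0 ≤ f₀ x := h₀.nonneg hμ hv hv0 hvB
  have hlow : ∀ x, Real.exp (-(√(zetaZero R₀ v) / √μ)) ≤ f x := fun x => by
    rcases le_total ‖x‖ L with h | h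
    · refine hexp.trans (le_trans ?_ (hin x h))
      rw [eq_profile_norm hf₀r]
      exact S.monotoneOn Set.self_mem_Ici (norm_nonneg x) (norm_nonneg x)
    · rw [hN.eq_one x h]; exact hexp1
  have hdiff : ∀ x, ‖x‖ ≤ L → |f₀ x - f x| ≤ 2 * (a / L) * f₀ x := fun x hx => by
    rw [eq_profile_norm hf₀r, eq_profile_norm hfr, hlen]
    exact N.abs_sub_le S hCL (norm_nonneg x) hx
  have hdiff' : ∀ x, |f₀ x - f x| ≤ 2 * (a / L) := fun x => by
    rcases le_total ‖x‖ L with h | h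
    · exact (hdiff x h).trans (mul_le_of_le_one_right (by positivity) (hf₀1 x))
    -- Outside the ball `f = 1` and `f₀ = 1 - a / |x|` exactly.
    · rw [hN.eq_one x h, eq_profile_norm hf₀r, S.eq_one_sub_div (by linarith), ← hlen]
      have h1 : a / ‖x‖ ≤ a / L := by gcongr
      have h2 : 0 ≤ a / ‖x‖ := by positivity
      rw [abs_le]
      constructor <;> linarith
  have hgrad1 : ∀ x, x ≠ 0 → ‖∇ f x‖ ≤ a * (1 + 100 * (R₀ / L)) / ‖x‖ ^ 2 := fun x hx => by
    have hx0 := norm_pos_iff.2 hx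
    rcases le_or_gt ‖x‖ L with h | h
    · rw [norm_gradient_of_radial hN.contDiff hfr hx]
      refine (N.abs_deriv_le_div_sq S hCL hx0 h).trans ?_
      rw [← hlen]
      gcongr
      norm_num
    · rw [gradient_eq_zero_of_lt_norm hN h, norm_zero]
      positivity
  have hgrad2 : ∀ x, x ≠ 0 → ‖∇ f x‖ ≤ (2 + 100 * (R₀ / L)) / ‖x‖ := fun x hx => by
    have hx0 := norm_pos_iff.2 hx
    rcases le_or_gt ‖x‖ L with h | h
    · rw [norm_gradient_of_radial hN.contDiff hfr hx]
      refine (N.abs_deriv_le_div S hCL hx0 h).trans ?_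
      gcongr
      have : 0 ≤ R₀ / L := by positivity
      linarith
    · rw [gradient_eq_zero_of_lt_norm hN h, norm_zero]
      positivity
  have hcf := hN.contDiff.continuous
  have hcf₀ := h₀.contDiff.continuous
  have hi : ∀ h : E3 → ℝ, Continuous h → Integrable fun x => v x * h x := fun h hh =>
    integrable_mul_continuous hv hv0 hvB hsupp hh
  refine ⟨?_, fun x => ⟨hlow x, hf1 x⟩, fun x hx => le_min (by linarith [hlow x]) ?_,
    fun x => (hdiff' x).trans (by linarith), ?_, ?_, fun x hx => ⟨hgrad1 x hx, hgrad2 x hx⟩, ?_⟩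
  · have h1 := N.energy_le S hCL
    rw [← hlen, div_le_iff₀ hμ] at h1
    have h2 : a / L ≤ R₀ / L := by gcongr
    calc neumannEnergy μ v L ≤ 3 * a / L ^ 3 * (1 + 4 * (a / L)) * μ := h1
      _ ≤ 3 * a / L ^ 3 * (1 + 100 * (R₀ / L)) * μ := by gcongr; norm_num
      _ = _ := by ring
  · have hx0 := norm_pos_iff.2 hx
    rcases le_total ‖x‖ L with h | h
    · have h1 := S.one_sub_div_le hx0
      rw [← hlen, ← eq_profile_norm hf₀r] at h1
      linarith [hin x h]
    · rw [hN.eq_one x h, sub_self]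
      positivity
  · rw [← hvf₀, ← integral_sub (hi f hcf) (hi f₀ hcf₀)]
    calc |∫ x, (v x * f x - v x * f₀ x)| ≤ ∫ x, v x * (2 * (a / L)) := by
          refine norm_integral_le_of_norm_le (f := fun x => v x * f x - v x * f₀ x)
            (hi _ continuous_const) (Eventually.of_forall fun x => ?_)
          rw [← mul_sub, norm_mul, Real.norm_of_nonneg (hv0 x), Real.norm_eq_abs, abs_sub_comm]
          exact mul_le_mul_of_nonneg_left (hdiff' x) (hv0 x)
      _ = (∫ x, v x) * (2 * (a / L)) := integral_mul_const _ _
      _ ≤ (∫ x, v x) * (100 * (a / L)) := by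
          have := integral_nonneg (μ := volume) (f := v) hv0
          gcongr
          norm_num
      _ = _ := by ring
  · rw [← integral_sub (hi (fun x => f x ^ 2) (hcf.pow 2)) (hi (fun x => f₀ x ^ 2) (hcf₀.pow 2))]
    -- Keeping `f₀` in the bound on `|f₀ - f|` replaces `∫ v` by `∫ v f₀ = 4 π μ a`; one of the two
    -- factors `a` is then bounded by `R₀`.
    calc |∫ x, (v x * f x ^ 2 - v x * f₀ x ^ 2)| ≤ ∫ x, 4 * (a / L) * (v x * f₀ x) := by
          refine norm_integral_le_of_norm_le (f := fun x => v x * f x ^ 2 - v x * f₀ x ^ 2)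
            ((hi _ hcf₀).const_mul _) (Eventually.of_forall fun x => ?_)
          rcases le_or_gt ‖x‖ L with h | h
          · have e1 : v x * f x ^ 2 - v x * f₀ x ^ 2 = v x * ((f x - f₀ x) * (f x + f₀ x)) := by
              ring
            have e2 : 0 ≤ f x + f₀ x := by linarith [hf₀0 x, hin x h]
            have e3 : f x + f₀ x ≤ 2 := by linarith [hf₀1 x, hf1 x]
            rw [e1, norm_mul, norm_mul, Real.norm_of_nonneg (hv0 x), Real.norm_of_nonneg e2,
              Real.norm_eq_abs, abs_sub_comm]
            have e4 := hdiff x h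
            calc v x * (|f₀ x - f x| * (f x + f₀ x)) ≤ v x * (2 * (a / L) * f₀ x * 2) := by
                  have := hv0 x
                  have := hf₀0 x
                  gcongr
              _ = _ := by ring
          · rw [hsupp x (by linarith)]
            simp
      _ = 4 * (a / L) * (4 * Real.pi * μ * a) := by rw [integral_const_mul, hvf₀]
      _ = (16 * Real.pi * a) * (μ * a / L) := by ring
      _ ≤ (100 * R₀) * (μ * a / L) := by
          have := Real.pi_lt_four
          have := Real.pi_pos
          gcongr
          linarith
  · intro x
    -- If `v` vanishes off the origin it is null: `a` and `ζ₀` are zero and the bound `hgrad1` gives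
    -- zero gradient, so no information on the capacity is needed.
    by_cases hne : ∃ y, y ≠ 0 ∧ v y ≠ 0
    · obtain ⟨R, hR, hRR₀, hsuppR, hK, hsph⟩ := exists_sphere_subset_tsupport hrad hsupp hne
      have hcap := le_electrostaticCapacity hR hK hsph
      set c := electrostaticCapacity (tsupport v)
      -- The same profile, now with the true support radius `R` in place of `R₀`: this gives `a ≤ R
      -- ≤ c`, and `R - a` can be replaced by `c - a`.
      have S' := h₀.isRadialScattering hμ hv hv0 hvB hrad hR hsuppR
      have hlen' := scatteringLength_eq hμ hrad hf₀r S'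
      have haR' : a ≤ R := by rw [ha, hlen']; exact S'.length_le
      have hζ : 0 ≤ zetaZero R₀ v := by rw [zetaZero]; positivity
      have hc : 0 ≤ c - a := by linarith
      have hrhs : 0 ≤ 100 / (‖x‖ ^ 2 + R₀ ^ 2) * (a + (c - a) / μ * zetaZero R₀ v) := by
        positivity
      rcases eq_or_ne x 0 with rfl | hx
      · simpa only [gradient_zero_of_radial hN.contDiff hfr, norm_zero] using hrhs
      rcases le_or_gt ‖x‖ L with h | h
      · rw [norm_gradient_of_radial hN.contDiff hfr hx]
        have h1 := N.abs_deriv_le_of_ae_le S' hRR₀ hCL (div_nonneg hM0 hμ.le) haeK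
          (norm_pos_iff.2 hx) h
        rw [← hlen', ← ha] at h1
        refine h1.trans ?_
        have h2 : (R - a) * (M / μ * R₀ ^ 2) ≤ (c - a) / μ * zetaZero R₀ v := by
          have e : (c - a) / μ * zetaZero R₀ v = (c - a) * (M / μ * R₀ ^ 2) := by
            rw [zetaZero]; ring
          rw [e]
          gcongr
        have h3 : 0 ≤ (R - a) * (M / μ * R₀ ^ 2) := by
          have := sub_nonneg.2 haR'
          positivity
        gcongr
        norm_num
      · rw [gradient_eq_zero_of_lt_norm hN h, norm_zero]
        exact hrhs
    · push Not at hne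
      have hae : v =ᵐ[volume] 0 := by
        have : ∀ᵐ y : E3, y ≠ 0 := by simp [ae_iff, measure_singleton]
        filter_upwards [this] with y hy
        exact hne y hy
      have ha' : a = 0 := scatteringLength_eq_zero hae
      rw [zetaZero_eq_zero R₀ hae, ha']
      rcases eq_or_ne x 0 with rfl | hx
      · rw [gradient_zero_of_radial hN.contDiff hfr]
        simp
      · have h1 := hgrad1 x hx
        rw [ha'] at h1
        simpa using h1
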